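/- Let $4\le p<6$ and $k\ge 0$. For $\theta>0$ and $\mu\in\mathbb R$ consider on $\mathbb R$ the equation $$-u''+\mu u-k\,(u^2)''\,u-\theta|u|^{p-2}u=0. \qquad (E_{\mu,\theta})$$ A real-valued $u\in H^1(\mathbb R)$ is called a (weak) solution of $(E_{\mu,\theta})$ if $$\int_{\mathbb R}u'v'+\mu\int_{\mathbb R}uv+k\int_{\mathbb R}(u^2)'(uv)'-\theta\int_{\mathbb R}|u|^{p-2}uv=0\qquad\text{for all } v\in H^1(\mathbb R),$$ and a positive solution if moreover its continuous representative satisfies $u(x)>0$ for all $x\in\mathbb R$. For $\lambda>0$ put $$\mathcal M_\lambda=\Big\{w\in H^1(\mathbb R;\mathbb C):\ \tfrac12\int_{\mathbb R}|w|^2=\lambda\Big\},\qquad I_\theta(w)=\int_{\mathbb R}\Big[\tfrac12|w'|^2+\tfrac k4\big|(|w|^2)'\big|^2-\tfrac\theta p|w|^p\Big].$$ 1. For every $\lambda>0$ and every $\theta>0$ there are $\gamma<0$ and a positive solution $u\in H^1(\mathbb R)$ of $(E_{\mu,\theta})$ with $\mu=-\gamma$ such that $u\in\mathcal M_\lambda$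 and $I_\theta(u)=\min_{\mathcal M_\lambda}I_\theta$; that is, $u$ is a minimizer of $I_\theta$ on $\mathcal M_\lambda$ with Lagrange multiplier $\gamma$. 2. There is $\gamma<0$ such that, for every $\theta>0$, the equation $(E_{\mu,\theta})$ with $\mu=-\gamma$ has a positive solution $u\in H^1(\mathbb R)$. -/

import Mathlib

open MeasureTheory
open scoped ContDiff

noncomputable section

/-- `g` is a weak (distributional) derivative of `f` on the real line:
both are locally integrable and `∫ f φ' = - ∫ g φ` for every `φ ∈ C_c^∞(ℝ)`. -/
def HasWeakDeriv {E : Type*} [NormedAddCommGroup E] [NormedSpace ℝ E] (f g : ℝ → E) : Prop :=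
  LocallyIntegrable f volume ∧ LocallyIntegrable g volume ∧
    ∀ φ : ℝ → ℝ, ContDiff ℝ ∞ φ → HasCompactSupport φ →
      ∫ x, deriv φ x • f x = - ∫ x, φ x • g x

open Classical in
/-- The weak derivative of `f` (unique up to a null set, see `HasWeakDeriv.weakDeriv_ae_eq`);
the value is `0` if `f` has no weak derivative. -/
def weakDeriv {E : Type*} [NormedAddCommGroup E] [NormedSpace ℝ E] (f : ℝ → E) : ℝ → E :=
  if h : ∃ g, HasWeakDeriv f g then h.choose else 0

theorem HasWeakDeriv.weakDeriv_ae_eq {E : Type*} [NormedAddCommGroup E] [NormedSpace ℝ E]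
    [CompleteSpace E] {f g : ℝ → E} (h : HasWeakDeriv f g) : weakDeriv f =ᵐ[volume] g := by
  have hex : ∃ g, HasWeakDeriv f g := ⟨g, h⟩
  have hs : HasWeakDeriv f (weakDeriv f) := by
    rw [weakDeriv, dif_pos hex]
    exact hex.choose_spec
  refine ae_eq_of_integral_contDiff_smul_eq hs.2.1 h.2.1 fun φ hφ hc => ?_
  have h1 := hs.2.2 φ hφ hc
  have h2 := h.2.2 φ hφ hc
  rw [h1] at h2
  exact neg_injective h2

/-- `f ∈ H¹(ℝ) = W^{1,2}(ℝ)`: `f ∈ L²` and `f` has a weak derivative in `L²`. -/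
def MemH1 {E : Type*} [NormedAddCommGroup E] [NormedSpace ℝ E] (f : ℝ → E) : Prop :=
  MemLp f 2 volume ∧ ∃ g, HasWeakDeriv f g ∧ MemLp g 2 volume

/-- The energy `I(u) = ∫ (1/2)|u'|² + (k/4)|(|u|²)'|² - (θ/p)|u|^p`. -/
def energy (k θ p : ℝ) (u : ℝ → ℂ) : ℝ :=
  ∫ x, (1 / 2 * ‖weakDeriv u x‖ ^ 2
    + k / 4 * (weakDeriv (fun y => ‖u y‖ ^ 2) x) ^ 2
    - θ / p * ‖u x‖ ^ p)

/-- The constraint set `{u ∈ H¹(ℝ; ℂ) : (1/2) ∫ |u|² = lam}`. -/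
def massSphere (lam : ℝ) : Set (ℝ → ℂ) :=
  {u | MemH1 u ∧ 1 / 2 * ∫ x, ‖u x‖ ^ 2 = lam}

/-- A real-valued `u ∈ H¹(ℝ)` is a weak solution of
`-u'' + μ u - k (u²)'' u - θ |u|^{p-2} u = 0`, tested against all `v ∈ H¹(ℝ)`. -/
def IsWeakSolution (k θ μ p : ℝ) (u : ℝ → ℝ) : Prop :=
  MemH1 u ∧ ∀ v : ℝ → ℝ, MemH1 v →
    (∫ x, weakDeriv u x * weakDeriv v x) + μ * (∫ x, u x * v x)
      + k * (∫ x, weakDeriv (fun y => u y ^ 2) x * weakDeriv (fun y => u y * v y) x)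
      - θ * (∫ x, |u x| ^ (p - 2) * u x * v x) = 0

/-- A positive solution: a weak solution whose continuous representative is positive everywhere. -/
def IsPositiveSolution (k θ μ p : ℝ) (u : ℝ → ℝ) : Prop :=
  Continuous u ∧ (∀ x, 0 < u x) ∧ IsWeakSolution k θ μ p u

end

open Filter Topology Set

/-! Put q = p - 2, c = 2θ/p and ρ = |w|². No compactness of minimizing sequences is needed: the
constrained problem reduces to minimizing a function of one variable, the maximal modulus.

If |w| has maximum M, the energy density plus c M^q ρ/2 dominates |Q(ρ) ρ'|/2 pointwise, where Q(σ)²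
= (1 + 2kσ)(c M^q - c σ^(q/2)); this is AM-GM (`half_abs_mul_sqrt_le`) after |ρ'| ≤ 2|w||w'|. Since
ρ climbs from 0 to M² and returns to 0, integration gives `action` M = ∫₀^{M²} Q as a lower bound
(`action_le`). On mass `lam` the energy is therefore at least `action` M - c M^q `lam`. As q < 4,
this reduced energy attains its minimum at some U > 0 (`exists_isMin_action_sub`).

Equality holds for the even soliton with maximum U, whose first integral is exactly the equality
case (`exists_isSoliton`, `IsSoliton.action_eq`). It solves the equation with μ = c U^q. It remains
to see that its mass is `lam` (`IsSoliton.mass_eq`): the lower bound applied to tu, together with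
the minimality of U, makes t = 1 a local minimum of an explicit function of t, and its vanishing
derivative combined with the Nehari identity forces the mass. In this way `action` is never
differentiated in M.

For the second claim, every μ > 0 is c U^q for some U, whatever θ is. -/

/-! ### Calculus of locally absolutely continuous functions on the line. -/

/-- `F` is locally absolutely continuous on the line with almost everywhere derivative `f`. -/
structure LocAC (F f : ℝ → ℝ) : Prop where
  ac : ∀ a b, AbsolutelyContinuousOnInterval F a b
  ae_hasDerivAt : ∀ᵐ x, HasDerivAt F (f x) x

namespace LocAC

variable {F f G g : ℝ → ℝ}

theorem continuous (h : LocAC F f) : Continuous F := by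
  rw [continuous_iff_continuousAt]
  intro x
  have := (h.ac (x - 1) (x + 1)).continuousOn
  refine this.continuousAt ?_
  rw [uIcc_of_le (by linarith)]
  exact Icc_mem_nhds (by linarith) (by linarith)

theorem deriv_ae_eq (h : LocAC F f) : deriv F =ᵐ[volume] f :=
  h.ae_hasDerivAt.mono fun _ hx => hx.deriv

theorem intervalIntegrable (h : LocAC F f) (a b : ℝ) : IntervalIntegrable f volume a b :=
  (h.ac a b).intervalIntegrable_deriv.congr_ae (ae_restrict_of_ae h.deriv_ae_eq)

theorem locallyIntegrable (h : LocAC F f) : LocallyIntegrable f volume := by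
  intro x
  refine ⟨Ioc (x - 1) (x + 1), Ioc_mem_nhds (by linarith) (by linarith), ?_⟩
  exact (intervalIntegrable_iff_integrableOn_Ioc_of_le (by linarith)).1 (h.intervalIntegrable _ _)

theorem integral_eq_sub (h : LocAC F f) (a b : ℝ) : ∫ x in a..b, f x = F b - F a := by
  rw [← (h.ac a b).integral_deriv_eq_sub]
  refine intervalIntegral.integral_congr_ae (h.deriv_ae_eq.mono fun x hx _ => hx.symm)

theorem of_integral (hf : LocallyIntegrable f volume) (C : ℝ) :
    LocAC (fun x => C + ∫ t in (0 : ℝ)..x, f t) f := by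
  have hi : ∀ a b, IntervalIntegrable f volume a b := fun a b =>
    intervalIntegrable_iff.mpr
      ((hf.integrableOn_isCompact isCompact_uIcc).mono_set uIoc_subset_uIcc)
  refine ⟨fun a b => ?_, ?_⟩
  · have h1 : AbsolutelyContinuousOnInterval (fun x => ∫ t in (0 : ℝ)..x, f t) a b := by
      refine ((hi (min a 0 ⊓ b) (max a 0 ⊔ b)).absolutelyContinuousOnInterval_intervalIntegral
        (c := 0) ?_).mono ?_
      · rw [mem_uIcc]; left; simp
      · rw [uIcc_of_le (a := min a 0 ⊓ b) (by simp)]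
        exact uIcc_subset_Icc (by simp) (by simp)
    have h2 : AbsolutelyContinuousOnInterval (fun _ : ℝ => C) a b :=
      (contDiff_const.contDiffOn).absolutelyContinuousOnInterval
    exact h2.add h1
  · filter_upwards [_root_.LocallyIntegrable.ae_hasDerivAt_integral hf] with x hx
    exact (hx 0).const_add C

theorem of_hasDerivAt (h : ∀ x, HasDerivAt F (f x) x) (hf : Continuous f) : LocAC F f := by
  refine ⟨fun a b => ContDiffOn.absolutelyContinuousOnInterval ?_, ae_of_all _ h⟩
  have hd : deriv F = f := funext fun x => (h x).deriv
  exact (contDiff_one_iff_deriv.2 ⟨fun x => (h x).differentiableAt, hd ▸ hf⟩).contDiffOn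

theorem add (hF : LocAC F f) (hG : LocAC G g) :
    LocAC (fun x => F x + G x) (fun x => f x + g x) :=
  ⟨fun a b => (hF.ac a b).add (hG.ac a b), by
    filter_upwards [hF.ae_hasDerivAt, hG.ae_hasDerivAt] with x h1 h2 using h1.add h2⟩

theorem mul (hF : LocAC F f) (hG : LocAC G g) :
    LocAC (fun x => F x * G x) (fun x => f x * G x + F x * g x) :=
  ⟨fun a b => (hF.ac a b).mul (hG.ac a b), by
    filter_upwards [hF.ae_hasDerivAt, hG.ae_hasDerivAt] with x h1 h2 using h1.mul h2⟩

theorem sq (hF : LocAC F f) : LocAC (fun x => F x ^ 2) (fun x => 2 * F x * f x) := by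
  have := hF.mul hF
  convert this using 2 <;> ring

/-- Chain rule for a `C¹` outer function. -/
theorem comp (hF : LocAC F f) (hG : ∀ s, HasDerivAt G (g s) s) (hg : Continuous g) :
    LocAC (fun x => G (F x)) (fun x => g (F x) * f x) := by
  refine ⟨fun a b => ?_, hF.ae_hasDerivAt.mono fun x hx => (hG (F x)).comp x hx⟩
  -- A `C¹` outer function is Lipschitz on the compact range of `F` over the interval, and
  -- composition with a Lipschitz map preserves absolute continuity. Dividing by `K + 1` below
  -- covers `K = 0`.
  obtain ⟨B, hB⟩ := (hF.ac a b).exists_bound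
  have hd : deriv G = g := funext fun x => (hG x).deriv
  have hC : ContDiff ℝ 1 G :=
    contDiff_one_iff_deriv.2 ⟨fun x => (hG x).differentiableAt, hd ▸ hg⟩
  obtain ⟨K, hK⟩ := (hC.contDiffOn (s := Icc (-B) B)).exists_lipschitzOnWith (by decide)
    (convex_Icc _ _) isCompact_Icc
  have hmem : ∀ x ∈ uIcc a b, F x ∈ Icc (-B) B := fun x hx => abs_le.1 (hB x hx)
  rw [absolutelyContinuousOnInterval_iff]
  intro ε hε
  obtain ⟨δ, hδ, H⟩ := (absolutelyContinuousOnInterval_iff F a b).1 (hF.ac a b) (ε / (K + 1))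
    (by positivity)
  refine ⟨δ, hδ, fun E hE hE' => ?_⟩
  have h1 := H E hE hE'
  calc _ ≤ ∑ i ∈ Finset.range E.1, K * dist (F (E.2 i).1) (F (E.2 i).2) := by
        refine Finset.sum_le_sum fun i hi => ?_
        exact hK.dist_le_mul _ (hmem _ (hE.1 i hi).1) _ (hmem _ (hE.1 i hi).2)
    _ = K * ∑ i ∈ Finset.range E.1, dist (F (E.2 i).1) (F (E.2 i).2) :=
        (Finset.mul_sum _ _ _).symm
    _ ≤ K * (ε / (K + 1)) := by gcongr
    _ < (K + 1) * (ε / (K + 1)) := by gcongr; linarith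
    _ = ε := by field_simp

/-- Integrability of `f` makes `F` converge; a nonzero limit would contradict integrability of `F`
on a half-line of infinite measure. -/
theorem tendsto_atTop_zero (h : LocAC F f) (hF : Integrable F) (hf : Integrable f) :
    Tendsto F atTop (𝓝 0) := by
  have h1 := intervalIntegral_tendsto_integral_Ioi 0 hf.integrableOn tendsto_id
  have h2 : Tendsto F atTop (𝓝 (F 0 + ∫ x in Ioi 0, f x)) := by
    refine (h1.const_add (F 0)).congr fun x => ?_
    rw [h.integral_eq_sub]; simp
  have h3 := IntegrableAtFilter.eq_zero_of_tendsto (μ := volume)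
    (hF.integrableAtFilter atTop) (fun s hs => by
      rcases mem_atTop_sets.1 hs with ⟨b, hb⟩
      rw [← top_le_iff, ← Real.volume_Ici (a := b)]
      exact measure_mono hb) h2
  rwa [h3] at h2

theorem tendsto_atBot_zero (h : LocAC F f) (hF : Integrable F) (hf : Integrable f) :
    Tendsto F atBot (𝓝 0) := by
  have h1 := intervalIntegral_tendsto_integral_Iic 0 hf.integrableOn tendsto_id
  have h2 : Tendsto F atBot (𝓝 (F 0 - ∫ x in Iic 0, f x)) := by
    refine (h1.const_sub (F 0)).congr fun x => ?_
    rw [h.integral_eq_sub]; simp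
  have h3 := IntegrableAtFilter.eq_zero_of_tendsto (μ := volume)
    (hF.integrableAtFilter atBot) (fun s hs => by
      rcases mem_atBot_sets.1 hs with ⟨b, hb⟩
      rw [← top_le_iff, ← Real.volume_Iic (a := b)]
      exact measure_mono hb) h2
  rwa [h3] at h2

theorem integral_eq_zero (h : LocAC F f) (hF : Integrable F) (hf : Integrable f) :
    ∫ x, f x = 0 := by
  have h1 := intervalIntegral_tendsto_integral hf tendsto_neg_atTop_atBot tendsto_id
  have h2 := (h.tendsto_atTop_zero hF hf).sub
    ((h.tendsto_atBot_zero hF hf).comp tendsto_neg_atTop_atBot)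
  rw [sub_zero] at h2
  refine tendsto_nhds_unique h1 (h2.congr fun x => ?_)
  rw [h.integral_eq_sub]; rfl

/-- Integration by parts on the line for square integrable functions. -/
theorem integral_mul_add_mul_eq_zero (hF : LocAC F f) (hG : LocAC G g)
    (mF : MemLp F 2) (mf : MemLp f 2) (mG : MemLp G 2) (mg : MemLp g 2) :
    ∫ x, (f x * G x + F x * g x) = 0 :=
  (hF.mul hG).integral_eq_zero (mF.integrable_mul mG)
    ((mf.integrable_mul mG).add (mF.integrable_mul mg))

theorem hasWeakDeriv (h : LocAC F f) : HasWeakDeriv F f := by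
  refine ⟨h.continuous.locallyIntegrable, h.locallyIntegrable, fun φ hφ hc => ?_⟩
  have hφ' : Continuous (deriv φ) := hφ.continuous_deriv (by simp)
  have hL : LocAC φ (deriv φ) :=
    of_hasDerivAt (fun x => (hφ.differentiable (by simp) x).hasDerivAt) hφ'
  have i1 : Integrable (fun x => deriv φ x * F x) :=
    (hφ'.mul h.continuous).integrable_of_hasCompactSupport hc.deriv.mul_right
  have i2 : Integrable (fun x => φ x * f x) :=
    h.locallyIntegrable.integrable_smul_left_of_hasCompactSupport hφ.continuous hc
  have i3 : Integrable (fun x => φ x * F x) :=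
    (hφ.continuous.mul h.continuous).integrable_of_hasCompactSupport hc.mul_right
  have := (hL.mul h).integral_eq_zero i3 (i1.add i2)
  rw [integral_add i1 i2] at this
  simp only [smul_eq_mul]
  linarith

end LocAC

/-! ### Weak derivatives and absolutely continuous representatives. -/

theorem HasWeakDeriv.congr {E : Type*} [NormedAddCommGroup E] [NormedSpace ℝ E]
    {f g f' g' : ℝ → E} (h : HasWeakDeriv f g) (hf : f =ᵐ[volume] f') (hg : g =ᵐ[volume] g') :
    HasWeakDeriv f' g' := by
  refine ⟨h.1.congr hf, h.2.1.congr hg, fun φ h1 h2 => ?_⟩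
  have := h.2.2 φ h1 h2
  rw [integral_congr_ae (g := fun x => deriv φ x • f x)
      (by filter_upwards [hf] with x hx; rw [hx]),
    integral_congr_ae (f := fun x => φ x • g' x) (g := fun x => φ x • g x)
      (by filter_upwards [hg] with x hx; rw [hx]), this]

/-- A locally integrable function with vanishing weak derivative is almost everywhere constant. -/
theorem ae_eq_const_of_hasWeakDeriv_zero {f : ℝ → ℝ} (h : HasWeakDeriv f 0) :
    ∃ C : ℝ, ∀ᵐ x, f x = C := by
  let b : ContDiffBump (0 : ℝ) := default
  let η : ℝ → ℝ := b.normed volume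
  have hη : ContDiff ℝ ∞ η := b.contDiff_normed
  have hηc : HasCompactSupport η := b.hasCompactSupport_normed
  have hη1 : ∫ x, η x = 1 := b.integral_normed
  -- A test function of mean zero is the derivative of a test function, so `f` annihilates it.
  -- Subtracting `(∫ φ) η` from a general `φ` reduces to this case.
  have key : ∀ φ : ℝ → ℝ, ContDiff ℝ ∞ φ → HasCompactSupport φ → ∫ x, φ x = 0 →
      ∫ x, φ x * f x = 0 := by
    intro φ hφ hc h0
    set Φ : ℝ → ℝ := fun x => ∫ t in Iic x, φ t with hΦ
    have hint : Integrable φ := hφ.continuous.integrable_of_hasCompactSupport hc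
    have hd : ∀ x, HasDerivAt Φ (φ x) x := by
      intro x
      have e : Φ = fun y => (∫ t in Iic 0, φ t) + ∫ t in (0:ℝ)..y, φ t := by
        funext y
        rw [← intervalIntegral.integral_Iic_sub_Iic hint.integrableOn hint.integrableOn]
        simp [hΦ]
      rw [e]
      exact (intervalIntegral.integral_hasDerivAt_right (hφ.continuous.intervalIntegrable _ _)
        (hφ.continuous.stronglyMeasurableAtFilter _ _) hφ.continuous.continuousAt).const_add _
    have hd' : deriv Φ = φ := funext fun x => (hd x).deriv
    have hΦs : ContDiff ℝ ∞ Φ := by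
      rw [contDiff_infty_iff_deriv]
      exact ⟨fun x => (hd x).differentiableAt, hd' ▸ hφ⟩
    have hΦc : HasCompactSupport Φ := by
      obtain ⟨R, hR⟩ := hc.isCompact.isBounded.subset_closedBall 0
      have hz : ∀ x, R < |x| → φ x = 0 := by
        intro x hx
        by_contra hne
        have := hR (subset_tsupport _ hne)
        simp at this; linarith
      refine HasCompactSupport.intro (isCompact_closedBall (0 : ℝ) R) fun x hx => ?_
      simp only [Metric.mem_closedBall, dist_zero_right, Real.norm_eq_abs, not_le] at hx
      rcases le_or_gt x 0 with h1 | h1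
      · rw [hΦ]
        refine setIntegral_eq_zero_of_forall_eq_zero fun t ht => hz t ?_
        rw [abs_of_nonpos h1] at hx
        rw [abs_of_nonpos (le_trans ht h1)]
        have : t ≤ x := ht
        linarith
      · have h2 : ∫ t in Ioi x, φ t = 0 := by
          refine setIntegral_eq_zero_of_forall_eq_zero fun t ht => hz t ?_
          have : x < t := ht
          rw [abs_of_pos h1] at hx
          rw [abs_of_pos (h1.trans this)]
          linarith
        have h3 := intervalIntegral.integral_Iic_add_Ioi (b := x) hint.integrableOn
          hint.integrableOn
        rw [h2, h0, add_zero] at h3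
        exact h3
    have := h.2.2 Φ hΦs hΦc
    simpa [hd'] using this
  refine ⟨∫ x, η x * f x, ?_⟩
  set C := ∫ x, η x * f x with hC
  have hcl : LocallyIntegrable (fun _ : ℝ => C) := continuous_const.locallyIntegrable
  refine ae_eq_of_integral_contDiff_smul_eq (f' := fun _ => C) h.1 hcl fun φ hφ hc => ?_
  have hint : Integrable φ := hφ.continuous.integrable_of_hasCompactSupport hc
  have hinη : Integrable η := hη.continuous.integrable_of_hasCompactSupport hηc
  have h1 := key (fun x => φ x - (∫ y, φ y) * η x) (hφ.sub (contDiff_const.mul hη))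
    (hc.sub hηc.mul_left) (by
      rw [integral_sub hint (hinη.const_mul _), integral_const_mul, hη1]; ring)
  have i1 : Integrable (fun x => φ x * f x) :=
    h.1.integrable_smul_left_of_hasCompactSupport hφ.continuous hc
  have i2 : Integrable (fun x => η x * f x) :=
    h.1.integrable_smul_left_of_hasCompactSupport hη.continuous hηc
  have h2 : ∫ x, (φ x - (∫ y, φ y) * η x) * f x
      = (∫ x, φ x * f x) - (∫ y, φ y) * C := by
    rw [hC, ← integral_const_mul, ← integral_sub i1 (i2.const_mul _)]
    congr 1; funext x; ring
  simp only [smul_eq_mul]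
  rw [integral_mul_const]
  linarith

/-- A weakly differentiable real function has a locally absolutely continuous representative. -/
theorem HasWeakDeriv.exists_locAC {f g : ℝ → ℝ} (h : HasWeakDeriv f g) :
    ∃ F : ℝ → ℝ, LocAC F g ∧ f =ᵐ[volume] F := by
  have hG := LocAC.of_integral h.2.1 0
  set G : ℝ → ℝ := fun x => 0 + ∫ t in (0 : ℝ)..x, g t with hGdef
  have hwG := hG.hasWeakDeriv
  have h0 : HasWeakDeriv (fun x => f x - G x) 0 := by
    refine ⟨h.1.sub hwG.1, locallyIntegrable_zero, fun φ hφ hc => ?_⟩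
    have hφ' : Continuous (deriv φ) := hφ.continuous_deriv (by simp)
    have i1 : Integrable (fun x => deriv φ x • f x) :=
      h.1.integrable_smul_left_of_hasCompactSupport hφ' hc.deriv
    have i2 : Integrable (fun x => deriv φ x • G x) :=
      hwG.1.integrable_smul_left_of_hasCompactSupport hφ' hc.deriv
    have e : ∀ x, deriv φ x • (f x - G x) = deriv φ x • f x - deriv φ x • G x := fun x => by
      rw [smul_sub]
    simp_rw [e]
    rw [integral_sub i1 i2, h.2.2 φ hφ hc, hwG.2.2 φ hφ hc]
    simp
  obtain ⟨C, hC⟩ := ae_eq_const_of_hasWeakDeriv_zero h0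
  refine ⟨fun x => C + ∫ t in (0 : ℝ)..x, g t, LocAC.of_integral h.2.1 C, ?_⟩
  filter_upwards [hC] with x hx
  simp only [hGdef] at hx
  linarith

theorem LocAC.weakDeriv_ae_eq {f F F' : ℝ → ℝ} (h : LocAC F F') (hf : f =ᵐ[volume] F) :
    weakDeriv f =ᵐ[volume] F' :=
  (h.hasWeakDeriv.congr hf.symm EventuallyEq.rfl).weakDeriv_ae_eq

theorem LocAC.memH1 {F F' : ℝ → ℝ} (h : LocAC F F') (h1 : MemLp F 2) (h2 : MemLp F' 2) :
    MemH1 F :=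
  ⟨h1, F', h.hasWeakDeriv, h2⟩

theorem MemH1.exists_locAC {f : ℝ → ℝ} (h : MemH1 f) :
    ∃ F F' : ℝ → ℝ, LocAC F F' ∧ f =ᵐ[volume] F ∧ MemLp F 2 ∧ MemLp F' 2 := by
  obtain ⟨h1, g, hg, h2⟩ := h
  obtain ⟨F, hF, hfF⟩ := hg.exists_locAC
  exact ⟨F, g, hF, hfF, h1.ae_eq hfF, h2⟩

theorem LocAC.integral_Iic_of_tendsto {F f : ℝ → ℝ} (h : LocAC F f) (hf : Integrable f) {L : ℝ}
    (hL : Tendsto F atBot (𝓝 L)) (a : ℝ) : ∫ x in Iic a, f x = F a - L := by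
  have h1 := intervalIntegral_tendsto_integral_Iic a hf.integrableOn tendsto_id
  refine tendsto_nhds_unique h1 ((hL.const_sub (F a)).congr fun x => ?_)
  rw [h.integral_eq_sub]; rfl

theorem LocAC.integral_Ioi_of_tendsto {F f : ℝ → ℝ} (h : LocAC F f) (hf : Integrable f) {L : ℝ}
    (hL : Tendsto F atTop (𝓝 L)) (a : ℝ) : ∫ x in Ioi a, f x = L - F a := by
  have h1 := intervalIntegral_tendsto_integral_Ioi a hf.integrableOn tendsto_id
  refine tendsto_nhds_unique h1 ((hL.sub_const (F a)).congr fun x => ?_)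
  rw [h.integral_eq_sub]; rfl

theorem HasWeakDeriv.clm_comp {E F : Type*} [NormedAddCommGroup E] [NormedSpace ℝ E]
    [CompleteSpace E] [NormedAddCommGroup F] [NormedSpace ℝ F] [CompleteSpace F]
    {f g : ℝ → E} (h : HasWeakDeriv f g) (L : E →L[ℝ] F) :
    HasWeakDeriv (fun x => L (f x)) (fun x => L (g x)) := by
  refine ⟨fun x => ?_, fun x => ?_, fun φ hφ hc => ?_⟩
  · obtain ⟨s, hs, hi⟩ := h.1 x
    exact ⟨s, hs, L.integrable_comp hi⟩
  · obtain ⟨s, hs, hi⟩ := h.2.1 x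
    exact ⟨s, hs, L.integrable_comp hi⟩
  · have hφ' : Continuous (deriv φ) := hφ.continuous_deriv (by simp)
    have i1 := h.1.integrable_smul_left_of_hasCompactSupport hφ' hc.deriv
    have i2 := h.2.1.integrable_smul_left_of_hasCompactSupport hφ.continuous hc
    simp_rw [← map_smul]
    rw [L.integral_comp_comm i1, L.integral_comp_comm i2, h.2.2 φ hφ hc, map_neg]

/-- Real and imaginary parts of the continuous representative of a complex `H¹` function. -/
theorem MemH1.exists_locAC_re_im {w : ℝ → ℂ} (h : MemH1 w) :
    ∃ (A B : ℝ → ℝ) (g : ℝ → ℂ), LocAC A (fun x => (g x).re) ∧ LocAC B (fun x => (g x).im) ∧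
      (∀ᵐ x, (w x).re = A x ∧ (w x).im = B x) ∧ weakDeriv w =ᵐ[volume] g ∧
      MemLp A 2 ∧ MemLp B 2 ∧ MemLp (fun x => (g x).re) 2 ∧ MemLp (fun x => (g x).im) 2 := by
  obtain ⟨h1, g, hg, h2⟩ := h
  obtain ⟨A, hA, hA'⟩ := (hg.clm_comp Complex.reCLM).exists_locAC
  obtain ⟨B, hB, hB'⟩ := (hg.clm_comp Complex.imCLM).exists_locAC
  refine ⟨A, B, g, hA, hB, ?_, hg.weakDeriv_ae_eq, ?_, ?_, h2.re, h2.im⟩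
  · filter_upwards [hA', hB'] with x hx hx' using ⟨hx, hx'⟩
  · exact h1.re.ae_eq hA'
  · exact h1.im.ae_eq hB'

/-- The energy in terms of real and imaginary parts. -/
theorem energy_eq_integral {k θ p : ℝ} (hp : 0 < p) {w g : ℝ → ℂ} {A B : ℝ → ℝ}
    (hA : LocAC A (fun x => (g x).re)) (hB : LocAC B (fun x => (g x).im))
    (hw : ∀ᵐ x, (w x).re = A x ∧ (w x).im = B x) (hg : weakDeriv w =ᵐ[volume] g) :
    energy k θ p w = ∫ x, (1 / 2 * ((g x).re ^ 2 + (g x).im ^ 2)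
      + k / 4 * (2 * A x * (g x).re + 2 * B x * (g x).im) ^ 2
      - (2 * θ / p) / 2 * ((A x ^ 2 + B x ^ 2) * (A x ^ 2 + B x ^ 2) ^ ((p - 2) / 2))) := by
  have hn : ∀ z : ℂ, ‖z‖ ^ 2 = z.re ^ 2 + z.im ^ 2 := fun z => by
    rw [Complex.sq_norm, Complex.normSq_apply]; ring
  have hρ : weakDeriv (fun y => ‖w y‖ ^ 2) =ᵐ[volume]
      fun x => 2 * A x * (g x).re + 2 * B x * (g x).im := by
    refine (hA.sq.add hB.sq).weakDeriv_ae_eq ?_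
    filter_upwards [hw] with x hx
    rw [hn, hx.1, hx.2]
  refine integral_congr_ae ?_
  filter_upwards [hρ, hw, hg] with x h1 h2 h3
  rw [h1, h3, hn, ← h2.1, ← h2.2, ← hn (w x)]
  -- Zeros of `w` are treated apart because adding real exponents requires a positive base.
  have : ‖w x‖ ^ p = ‖w x‖ ^ 2 * (‖w x‖ ^ 2) ^ ((p - 2) / 2) := by
    rcases eq_or_lt_of_le (norm_nonneg (w x)) with h0 | h0
    · rw [← h0, Real.zero_rpow hp.ne']; simp
    · rw [← Real.rpow_natCast, ← Real.rpow_mul h0.le, ← Real.rpow_add h0]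
      congr 1; push_cast; ring
  rw [this]
  ring

/-! ### The action as a lower bound for the energy. -/

/-- The square root density whose primitive is the one-dimensional action. -/
noncomputable def actionDensity (k c q M σ : ℝ) : ℝ :=
  √((1 + 2 * k * σ) * (c * M ^ q - c * σ ^ (q / 2)))

/-- The action of the soliton with maximum `M`, as an integral over the squared modulus. -/
noncomputable def action (k c q M : ℝ) : ℝ := ∫ σ in (0 : ℝ)..M ^ 2, actionDensity k c q M σ

theorem continuous_actionDensity {k c q M : ℝ} (hq : 0 < q) :
    Continuous (actionDensity k c q M) := by
  have : Continuous fun σ : ℝ => σ ^ (q / 2) := Real.continuous_rpow_const (by positivity)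
  unfold actionDensity
  fun_prop

theorem hasDerivAt_integral_actionDensity {k c q M : ℝ} (hq : 0 < q) (s : ℝ) :
    HasDerivAt (fun s => ∫ σ in (0 : ℝ)..s, actionDensity k c q M σ)
      (actionDensity k c q M s) s :=
  have h := continuous_actionDensity (k := k) (c := c) (M := M) hq
  intervalIntegral.integral_hasDerivAt_right (h.intervalIntegrable _ _)
    (h.stronglyMeasurableAtFilter _ _) h.continuousAt

/-- AM-GM: since N ≥ r²/(4s), the gradient terms are at least r²(1 + 2ks)/(8s), and twice the
geometric mean of this with sT/2 is the left side. It is used with s = ρ, r = ρ', N = |w'|². -/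
theorem half_abs_mul_sqrt_le {k N r s T : ℝ} (hk : 0 ≤ k) (hs : 0 ≤ s) (hN : 0 ≤ N) (hT : 0 ≤ T)
    (hr : r ^ 2 ≤ 4 * s * N) :
    1 / 2 * (|r| * √((1 + 2 * k * s) * T)) ≤ 1 / 2 * N + k / 4 * r ^ 2 + 1 / 2 * s * T := by
  rcases eq_or_lt_of_le hs with h0 | h0
  · have : r = 0 := by
      rw [← h0] at hr
      nlinarith
    subst this
    simp only [abs_zero, zero_mul, mul_zero]
    positivity
  · set Y := √((1 + 2 * k * s) * T)
    have hα : 0 < 1 + 2 * k * s := by positivity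
    have hY : Y ^ 2 = (1 + 2 * k * s) * T := Real.sq_sqrt (by positivity)
    have h1 : r ^ 2 / (4 * s) ≤ N := by
      rw [div_le_iff₀ (by positivity)]; linarith
    -- The completed square; its vanishing is the first integral of the soliton.
    have h2 : 0 ≤ (|r| * (1 + 2 * k * s) - 2 * s * Y) ^ 2 / (8 * s * (1 + 2 * k * s)) := by
      positivity
    have h3 : (|r| * (1 + 2 * k * s) - 2 * s * Y) ^ 2 / (8 * s * (1 + 2 * k * s))
        = 1 / 2 * (r ^ 2 / (4 * s)) + k / 4 * r ^ 2 + 1 / 2 * s * T - 1 / 2 * (|r| * Y) := by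
      have : (|r| * (1 + 2 * k * s) - 2 * s * Y) ^ 2 = r ^ 2 * (1 + 2 * k * s) ^ 2
          + 4 * s ^ 2 * ((1 + 2 * k * s) * T) - 4 * s * |r| * (1 + 2 * k * s) * Y := by
        rw [← hY, ← sq_abs r]; ring
      rw [this]
      field_simp
      ring
    linarith

theorem rpow_half_le_rpow {q M s : ℝ} (hq : 0 < q) (hM : 0 < M) (hs : 0 ≤ s) (h : s ≤ M ^ 2) :
    s ^ (q / 2) ≤ M ^ q := by
  have : M ^ q = (M ^ 2) ^ (q / 2) := by
    rw [← Real.rpow_natCast, ← Real.rpow_mul hM.le]; congr 1; push_cast; ring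
  rw [this]
  exact Real.rpow_le_rpow hs h (by positivity)

section LowerBound

variable {A A' B B' : ℝ → ℝ} {k c q M : ℝ}

/-- Cauchy-Schwarz for ρ' = 2 Re(w̄ w'); the defect 4(ab' - ba')² is the contribution of the phase.
-/
theorem sq_deriv_le {a a' b b' : ℝ} :
    (2 * a * a' + 2 * b * b') ^ 2 ≤ 4 * (a ^ 2 + b ^ 2) * (a' ^ 2 + b' ^ 2) := by
  nlinarith [sq_nonneg (a * b' - b * a')]

theorem integrable_energy_terms (hA : LocAC A A') (hB : LocAC B B') (mA : MemLp A 2)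
    (mB : MemLp B 2) (mA' : MemLp A' 2) (mB' : MemLp B' 2) (hq : 0 < q) (hM : 0 < M)
    (hle : ∀ x, A x ^ 2 + B x ^ 2 ≤ M ^ 2) :
    Integrable (fun x => A' x ^ 2 + B' x ^ 2) ∧
    Integrable (fun x => (2 * A x * A' x + 2 * B x * B' x) ^ 2) ∧
    Integrable (fun x => (A x ^ 2 + B x ^ 2) * (A x ^ 2 + B x ^ 2) ^ (q / 2)) := by
  have cA := hA.continuous
  have cB := hB.continuous
  have iN : Integrable (fun x => A' x ^ 2 + B' x ^ 2) := mA'.integrable_sq.add mB'.integrable_sq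
  have iρ : Integrable (fun x => A x ^ 2 + B x ^ 2) := mA.integrable_sq.add mB.integrable_sq
  refine ⟨iN, ?_, ?_⟩
  · refine (iN.const_mul (4 * M ^ 2)).mono' ?_ (ae_of_all _ fun x => ?_)
    · have := mA'.aestronglyMeasurable
      have := mB'.aestronglyMeasurable
      have := cA.aestronglyMeasurable (μ := volume)
      have := cB.aestronglyMeasurable (μ := volume)
      fun_prop
    · rw [Real.norm_of_nonneg (sq_nonneg _)]
      refine sq_deriv_le.trans ?_
      gcongr
      exact hle x
  · refine (iρ.const_mul (M ^ q)).mono' ?_ (ae_of_all _ fun x => ?_)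
    · have : Continuous fun σ : ℝ => σ ^ (q / 2) := Real.continuous_rpow_const (by positivity)
      exact Continuous.aestronglyMeasurable (by fun_prop)
    · have h0 : 0 ≤ A x ^ 2 + B x ^ 2 := by positivity
      rw [Real.norm_of_nonneg (by positivity), mul_comm]
      gcongr
      exact rpow_half_le_rpow hq hM h0 (hle x)

/-- A function with maximal modulus `M` has at least the action of the soliton with maximum `M`. -/
theorem action_le (hA : LocAC A A') (hB : LocAC B B') (mA : MemLp A 2)
    (mB : MemLp B 2) (mA' : MemLp A' 2) (mB' : MemLp B' 2) (hk : 0 ≤ k) (hc : 0 < c)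
    (hq : 0 < q) (hM : 0 < M) (hle : ∀ x, A x ^ 2 + B x ^ 2 ≤ M ^ 2)
    {x₀ : ℝ} (hx₀ : A x₀ ^ 2 + B x₀ ^ 2 = M ^ 2) :
    action k c q M ≤ (∫ x, (1 / 2 * (A' x ^ 2 + B' x ^ 2)
      + k / 4 * (2 * A x * A' x + 2 * B x * B' x) ^ 2
      - c / 2 * ((A x ^ 2 + B x ^ 2) * (A x ^ 2 + B x ^ 2) ^ (q / 2))))
      + c * M ^ q * (1 / 2 * ∫ x, (A x ^ 2 + B x ^ 2)) := by
  obtain ⟨i1, i2, i3⟩ := integrable_energy_terms hA hB mA mB mA' mB' hq hM hle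
  have iρ : Integrable (fun x => A x ^ 2 + B x ^ 2) := mA.integrable_sq.add mB.integrable_sq
  have hρ := hA.sq.add hB.sq
  have iρ' : Integrable (fun x => 2 * A x * A' x + 2 * B x * B' x) := by
    have := ((mA.integrable_mul mA').const_mul 2).add ((mB.integrable_mul mB').const_mul 2)
    refine this.congr (ae_of_all _ fun x => ?_)
    simp only [Pi.add_apply, Pi.mul_apply]; ring
  have hQ := continuous_actionDensity (k := k) (c := c) (M := M) hq
  -- The primitive of the density composed with ρ vanishes at both infinities and equals the action
  -- at the maximum point.
  have hG := hρ.comp (hasDerivAt_integral_actionDensity (k := k) (c := c) (M := M) hq) hQ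
  obtain ⟨b, hb⟩ := isCompact_Icc.exists_bound_of_continuousOn (s := Icc 0 (M ^ 2))
    hQ.continuousOn
  have iG : Integrable (fun x => actionDensity k c q M (A x ^ 2 + B x ^ 2)
      * (2 * A x * A' x + 2 * B x * B' x)) := by
    refine iρ'.bdd_mul (c := b) (hQ.comp hρ.continuous).aestronglyMeasurable
      (ae_of_all _ fun x => hb _ ⟨by positivity, hle x⟩)
  have t1 := (hρ.tendsto_atBot_zero iρ iρ')
  have t2 := (hρ.tendsto_atTop_zero iρ iρ')
  have cG : Continuous (fun s => ∫ σ in (0 : ℝ)..s, actionDensity k c q M σ) :=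
    continuous_iff_continuousAt.2 fun s =>
      (hasDerivAt_integral_actionDensity (k := k) (c := c) (M := M) hq s).continuousAt
  have e1 := hG.integral_Iic_of_tendsto iG ((cG.tendsto 0).comp t1) x₀
  have e2 := hG.integral_Ioi_of_tendsto iG ((cG.tendsto 0).comp t2) x₀
  simp only [hx₀, intervalIntegral.integral_same] at e1 e2
  have hpt : ∀ x, 1 / 2 * |actionDensity k c q M (A x ^ 2 + B x ^ 2)
      * (2 * A x * A' x + 2 * B x * B' x)| ≤ (1 / 2 * (A' x ^ 2 + B' x ^ 2)
      + k / 4 * (2 * A x * A' x + 2 * B x * B' x) ^ 2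
      - c / 2 * ((A x ^ 2 + B x ^ 2) * (A x ^ 2 + B x ^ 2) ^ (q / 2)))
      + c * M ^ q * (1 / 2 * (A x ^ 2 + B x ^ 2)) := by
    intro x
    have h0 : 0 ≤ A x ^ 2 + B x ^ 2 := by positivity
    have hT : 0 ≤ c * M ^ q - c * (A x ^ 2 + B x ^ 2) ^ (q / 2) := by
      have := rpow_half_le_rpow hq hM h0 (hle x)
      nlinarith
    have := half_abs_mul_sqrt_le hk h0 (by positivity : 0 ≤ A' x ^ 2 + B' x ^ 2) hT
      (sq_deriv_le (a := A x) (b := B x))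
    rw [abs_mul, actionDensity, abs_of_nonneg (Real.sqrt_nonneg _), mul_comm (√_)]
    refine this.trans (le_of_eq ?_)
    ring
  have iE := ((i1.const_mul (1 / 2)).add (i2.const_mul (k / 4))).sub (i3.const_mul (c / 2))
  have iM := (iρ.const_mul (1 / 2)).const_mul (c * M ^ q)
  have step := integral_mono (iG.abs.const_mul (1 / 2)) (iE.add iM) hpt
  simp only [Pi.add_apply, Pi.sub_apply] at step
  rw [integral_add (by exact iE) iM, integral_const_mul, integral_const_mul,
    integral_const_mul] at step
  -- The rise to the left of the maximum and the fall to its right each contribute one full action,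
  -- which cancels the factor 1/2.
  have l1 : ∫ x in Iic x₀, actionDensity k c q M (A x ^ 2 + B x ^ 2)
      * (2 * A x * A' x + 2 * B x * B' x) ≤ ∫ x in Iic x₀, |actionDensity k c q M
      (A x ^ 2 + B x ^ 2) * (2 * A x * A' x + 2 * B x * B' x)| :=
    integral_mono iG.integrableOn iG.abs.integrableOn fun x => le_abs_self _
  have l2 : ∫ x in Ioi x₀, -(actionDensity k c q M (A x ^ 2 + B x ^ 2)
      * (2 * A x * A' x + 2 * B x * B' x)) ≤ ∫ x in Ioi x₀, |actionDensity k c q M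
      (A x ^ 2 + B x ^ 2) * (2 * A x * A' x + 2 * B x * B' x)| :=
    integral_mono iG.neg.integrableOn iG.abs.integrableOn fun x => neg_le_abs _
  have l3 := intervalIntegral.integral_Iic_add_Ioi (b := x₀) iG.abs.integrableOn
    iG.abs.integrableOn
  rw [integral_neg] at l2
  unfold action
  linarith

end LowerBound

/-- Lower bound for the energy of an `H¹` function by the action of a soliton. -/
theorem MemH1.exists_action_le {k θ p : ℝ} (hk : 0 ≤ k) (hθ : 0 < θ) (hp : 2 < p) {w : ℝ → ℂ}
    (hw : MemH1 w) (hm : 0 < ∫ x, ‖w x‖ ^ 2) :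
    ∃ M : ℝ, 0 < M ∧ action k (2 * θ / p) (p - 2) M
      ≤ energy k θ p w + 2 * θ / p * M ^ (p - 2) * (1 / 2 * ∫ x, ‖w x‖ ^ 2) := by
  obtain ⟨A, B, g, hA, hB, hAB, hg, mA, mB, mA', mB'⟩ := hw.exists_locAC_re_im
  have hmass : ∫ x, ‖w x‖ ^ 2 = ∫ x, (A x ^ 2 + B x ^ 2) := by
    refine integral_congr_ae ?_
    filter_upwards [hAB] with x hx
    rw [Complex.sq_norm, Complex.normSq_apply, hx.1, hx.2]; ring
  have iρ : Integrable (fun x => A x ^ 2 + B x ^ 2) := mA.integrable_sq.add mB.integrable_sq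
  have hρ := hA.sq.add hB.sq
  have iρ' : Integrable (fun x => 2 * A x * (g x).re + 2 * B x * (g x).im) := by
    have := ((mA.integrable_mul mA').const_mul 2).add ((mB.integrable_mul mB').const_mul 2)
    refine this.congr (ae_of_all _ fun x => ?_)
    simp only [Pi.add_apply, Pi.mul_apply]; ring
  obtain ⟨y, hy⟩ : ∃ y, 0 < A y ^ 2 + B y ^ 2 := by
    by_contra! hcon
    have : ∫ x, (A x ^ 2 + B x ^ 2) ≤ 0 := integral_nonpos hcon
    linarith
  have t1 := (hρ.tendsto_atBot_zero iρ iρ')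
  have t2 := (hρ.tendsto_atTop_zero iρ iρ')
  -- The squared modulus tends to 0 at infinity and is positive somewhere, so its maximum is
  -- attained.
  obtain ⟨x₀, hx₀⟩ := hρ.continuous.exists_forall_ge' (x₀ := y) (by
    rw [cocompact_eq_atBot_atTop]
    exact eventually_sup.2 ⟨(t1.eventually_lt_const hy).mono fun _ h => h.le,
      (t2.eventually_lt_const hy).mono fun _ h => h.le⟩)
  have hpos : 0 < A x₀ ^ 2 + B x₀ ^ 2 := hy.trans_le (hx₀ y)
  have hsq : √(A x₀ ^ 2 + B x₀ ^ 2) ^ 2 = A x₀ ^ 2 + B x₀ ^ 2 := Real.sq_sqrt hpos.le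
  refine ⟨√(A x₀ ^ 2 + B x₀ ^ 2), Real.sqrt_pos.2 hpos, ?_⟩
  rw [energy_eq_integral (by linarith) hA hB hAB hg, hmass]
  exact action_le hA hB mA mB mA' mB' hk (by positivity) (by linarith) (Real.sqrt_pos.2 hpos)
    (fun x => by rw [hsq]; exact hx₀ x) hsq.symm

/-! ### Minimization of the reduced energy. -/

/-- The substitution σ = U²τ isolates the power U^(2 + q/2), to be compared with U^q in the mass
term. -/
theorem action_eq {k c q U : ℝ} (hc : 0 < c) (hU : 0 ≤ U) (hq : 0 < q) :
    action k c q U = √c * U ^ (2 + q / 2) *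
      ∫ τ in (0 : ℝ)..1, √((1 + 2 * k * (U ^ 2 * τ)) * (1 - τ ^ (q / 2))) := by
  rcases eq_or_lt_of_le hU with h0 | h0
  · rw [← h0, Real.zero_rpow (by positivity)]
    simp [action]
  have h1 := intervalIntegral.smul_integral_comp_mul_left (a := 0) (b := 1)
    (actionDensity k c q U) (U ^ 2)
  rw [mul_zero, mul_one] at h1
  have e : ∀ τ ∈ uIcc (0 : ℝ) 1, actionDensity k c q U (U ^ 2 * τ) = √c * U ^ (q / 2)
      * √((1 + 2 * k * (U ^ 2 * τ)) * (1 - τ ^ (q / 2))) := by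
    intro τ hτ
    rw [uIcc_of_le zero_le_one] at hτ
    have hU2 : (U ^ 2) ^ (q / 2) = U ^ q := by
      rw [← Real.rpow_natCast, ← Real.rpow_mul hU]; congr 1; push_cast; ring
    have hU3 : √(U ^ q) = U ^ (q / 2) := by
      rw [Real.sqrt_eq_rpow, ← Real.rpow_mul hU]; congr 1; ring
    rw [actionDensity, Real.mul_rpow (by positivity) hτ.1, hU2, ← hU3, ← Real.sqrt_mul hc.le,
      ← Real.sqrt_mul (by positivity)]
    congr 1; ring
  rw [action, ← h1, intervalIntegral.integral_congr e, intervalIntegral.integral_const_mul,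
    smul_eq_mul, Real.rpow_add h0]
  norm_num
  ring

/-- The reduced energy `U ↦ action U - c U^q λ` attains its minimum over positive `U`. -/
theorem exists_isMin_action_sub {k c q lam : ℝ} (hk : 0 ≤ k) (hc : 0 < c) (hq : 0 < q)
    (hq4 : q < 4) (hlam : 0 < lam) :
    ∃ U : ℝ, 0 < U ∧ ∀ V : ℝ, 0 < V →
      action k c q U - c * U ^ q * lam ≤ action k c q V - c * V ^ q * lam := by
  set Ψ : ℝ → ℝ := fun U => ∫ τ in (0 : ℝ)..1, √((1 + 2 * k * (U ^ 2 * τ)) * (1 - τ ^ (q / 2)))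
  have hrp : Continuous fun σ : ℝ => σ ^ (q / 2) := Real.continuous_rpow_const (by positivity)
  have hΨ : Continuous Ψ := by
    refine intervalIntegral.continuous_parametric_intervalIntegral_of_continuous' ?_ 0 1
    have : Continuous fun z : ℝ × ℝ => z.2 ^ (q / 2) := hrp.comp continuous_snd
    simp only [Function.uncurry_def]
    fun_prop
  have hκ : 0 < Ψ 0 := by
    refine intervalIntegral.intervalIntegral_pos_of_pos_on ?_ ?_ zero_lt_one
    · exact Continuous.intervalIntegrable (by fun_prop) _ _
    · intro τ hτ
      refine Real.sqrt_pos.2 ?_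
      have : τ ^ (q / 2) < 1 := Real.rpow_lt_one hτ.1.le hτ.2 (by positivity)
      simp; linarith
  -- The quasilinear factor only increases the action, so the case k = 0 already supplies the
  -- growth.
  have hΨ0 : ∀ U, Ψ 0 ≤ Ψ U := by
    intro U
    refine intervalIntegral.integral_mono_on zero_le_one
      (Continuous.intervalIntegrable (by fun_prop) _ _)
      (Continuous.intervalIntegrable (by fun_prop) _ _) fun τ hτ => ?_
    have : τ ^ (q / 2) ≤ 1 := Real.rpow_le_one hτ.1 hτ.2 (by positivity)
    have h2 : 0 ≤ 2 * k * (U ^ 2 * τ) := by have := hτ.1; positivity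
    refine Real.sqrt_le_sqrt ?_
    refine mul_le_mul_of_nonneg_right ?_ (by linarith)
    simpa using h2
  set h : ℝ → ℝ := fun U => √c * U ^ (2 + q / 2) * Ψ U - c * U ^ q * lam with hh
  have hcont : Continuous h := by
    have h1 : Continuous fun σ : ℝ => σ ^ (2 + q / 2) := Real.continuous_rpow_const (by positivity)
    have h2 : Continuous fun σ : ℝ => σ ^ q := Real.continuous_rpow_const (by positivity)
    fun_prop
  have hact : ∀ U, 0 ≤ U → action k c q U - c * U ^ q * lam = h U := fun U hU => by
    rw [action_eq hc hU hq]
  -- The exponent 2 - q/2 is positive exactly when q < 4. Hence the bracket is negative near 0 and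
  -- nonnegative for large U, which confines the minimum to a compact interval away from 0.
  have hfac : ∀ U, 0 < U → h U = U ^ q * (√c * Ψ U * U ^ (2 - q / 2) - c * lam) := by
    intro U hU
    have : U ^ (2 + q / 2) = U ^ q * U ^ (2 - q / 2) := by
      rw [← Real.rpow_add hU]; congr 1; ring
    simp only [hh]; rw [this]; ring
  have hsc : 0 < √c := Real.sqrt_pos.2 hc
  have he : 0 < 2 - q / 2 := by linarith
  have h0 : h 0 = 0 := by
    simp only [hh]
    rw [Real.zero_rpow (by positivity), Real.zero_rpow hq.ne']; simp
  obtain ⟨V, hV, hVneg⟩ : ∃ V, 0 < V ∧ h V < 0 := by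
    have t : Tendsto (fun U : ℝ => √c * Ψ U * U ^ (2 - q / 2) - c * lam) (𝓝[>] 0)
        (𝓝 (√c * Ψ 0 * 0 ^ (2 - q / 2) - c * lam)) := by
      have h1 : Continuous fun σ : ℝ => σ ^ (2 - q / 2) := Real.continuous_rpow_const he.le
      exact (Continuous.tendsto (by fun_prop) 0).mono_left nhdsWithin_le_nhds
    rw [Real.zero_rpow he.ne', mul_zero, zero_sub] at t
    have := (t.eventually_lt_const (show -(c * lam) < 0 by
      have : 0 < c * lam := by positivity
      linarith)).and self_mem_nhdsWithin
    obtain ⟨V, hV1, hV2⟩ := this.exists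
    refine ⟨V, hV2, ?_⟩
    rw [hfac V hV2]
    exact mul_neg_of_pos_of_neg (Real.rpow_pos_of_pos hV2 _) hV1
  obtain ⟨R, hR⟩ : ∃ R, ∀ U, R ≤ U → 0 < U → 0 ≤ h U := by
    have t := ((tendsto_rpow_atTop he).const_mul_atTop (show 0 < √c * Ψ 0 by positivity))
    obtain ⟨R, hR⟩ := eventually_atTop.1 (t.eventually_ge_atTop (c * lam))
    refine ⟨R, fun U hU hU0 => ?_⟩
    rw [hfac U hU0]
    have h1 := hR U hU
    have h2 : √c * Ψ 0 * U ^ (2 - q / 2) ≤ √c * Ψ U * U ^ (2 - q / 2) := by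
      have := hΨ0 U
      gcongr
    refine mul_nonneg (Real.rpow_nonneg hU0.le _) ?_
    linarith
  obtain ⟨U, hU, hmin⟩ := isCompact_Icc.exists_isMinOn (s := Icc 0 (max R V))
    ⟨V, hV.le, le_max_right _ _⟩ hcont.continuousOn
  have hUneg : h U < 0 := (hmin ⟨hV.le, le_max_right _ _⟩).trans_lt hVneg
  have hUpos : 0 < U := by
    rcases eq_or_lt_of_le hU.1 with h1 | h1
    · rw [← h1, h0] at hUneg; exact absurd hUneg (lt_irrefl _)
    · exact h1
  refine ⟨U, hUpos, fun W hW => ?_⟩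
  rw [hact U hUpos.le, hact W hW.le]
  rcases le_or_gt W (max R V) with h1 | h1
  · exact hmin ⟨hW.le, h1⟩
  · exact hUneg.le.trans (hR W ((le_max_left _ _).trans h1.le) hW)

/-! ### Construction of the soliton. -/

/-- The autonomous equation `z' = 1 / D z` has a global solution through the origin. -/
theorem exists_hasDerivAt_inv {D : ℝ → ℝ} (hD : Continuous D) {m b : ℝ} (hm : 0 < m)
    (h1 : ∀ z, m ≤ D z) (h2 : ∀ z, D z ≤ b) :
    ∃ z : ℝ → ℝ, (∀ x, HasDerivAt z (D (z x))⁻¹ x) ∧ z 0 = 0 ∧ Monotone z ∧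
      ∀ x, |x| ≤ b * |z x| := by
  -- Separation of variables: the solution is the inverse of this increasing bijection. The upper
  -- bound on `D` makes the inverse grow at least linearly, which later gives decay.
  set X : ℝ → ℝ := fun z => ∫ t in (0 : ℝ)..z, D t with hX
  have hX0 : X 0 = 0 := by simp [hX]
  have hd : ∀ z, HasDerivAt X (D z) z := fun z =>
    intervalIntegral.integral_hasDerivAt_right (hD.intervalIntegrable _ _)
      (hD.stronglyMeasurableAtFilter _ _) hD.continuousAt
  have hmono : StrictMono X := strictMono_of_hasDerivAt_pos hd fun z => hm.trans_le (h1 z)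
  have hcont : Continuous X := continuous_iff_continuousAt.2 fun z => (hd z).continuousAt
  have hlow : Monotone fun z => X z - m * z := by
    have h : ∀ z, HasDerivAt (fun z => X z - m * z) (D z - m * 1) z := fun z =>
      (hd z).sub ((hasDerivAt_id z).const_mul m)
    refine monotone_of_deriv_nonneg (fun z => (h z).differentiableAt) fun z => ?_
    rw [(h z).deriv]; linarith [h1 z]
  have hupp : Monotone fun z => b * z - X z := by
    have h : ∀ z, HasDerivAt (fun z => b * z - X z) (b * 1 - D z) z := fun z =>
      ((hasDerivAt_id z).const_mul b).sub (hd z)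
    refine monotone_of_deriv_nonneg (fun z => (h z).differentiableAt) fun z => ?_
    rw [(h z).deriv]; linarith [h2 z]
  have htop : Tendsto X atTop atTop := by
    refine tendsto_atTop_mono' atTop ?_ (tendsto_id.const_mul_atTop hm)
    filter_upwards [eventually_ge_atTop 0] with z hz
    have := hlow hz
    simp only [hX0, mul_zero, sub_zero] at this
    simp only [id]; linarith
  have hbot : Tendsto X atBot atBot := by
    refine tendsto_atBot_mono' atBot ?_ (tendsto_id.const_mul_atBot hm)
    filter_upwards [eventually_le_atBot 0] with z hz
    have := hlow hz
    simp only [hX0, mul_zero, sub_zero] at this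
    simp only [id]; linarith
  have hsurj : Function.Surjective X := hcont.surjective htop hbot
  let e : ℝ ≃o ℝ := hmono.orderIsoOfSurjective X hsurj
  have hXe : ∀ x, X (e.symm x) = x := fun x => e.apply_symm_apply x
  have hz0 : e.symm 0 = 0 := by
    apply hmono.injective
    rw [hXe, hX0]
  refine ⟨e.symm, fun x => ?_, hz0, e.symm.monotone, fun x => ?_⟩
  · exact HasDerivAt.of_local_left_inverse e.symm.continuous.continuousAt (hd _)
      (hm.trans_le (h1 _)).ne' (Eventually.of_forall hXe)
  · rcases le_total 0 x with hx | hx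
    · have hz : 0 ≤ e.symm x := hz0 ▸ e.symm.monotone hx
      have := hupp hz
      simp only [hX0, mul_zero, sub_zero, hXe] at this
      rw [abs_of_nonneg hx, abs_of_nonneg hz]; linarith
    · have hz : e.symm x ≤ 0 := hz0 ▸ e.symm.monotone hx
      have := hupp hz
      simp only [hX0, mul_zero, sub_zero, hXe] at this
      rw [abs_of_nonpos hx, abs_of_nonpos hz]; linarith

theorem one_add_sq_div_two_le_cosh (z : ℝ) : 1 + z ^ 2 / 2 ≤ Real.cosh z := by
  have h1 : Real.cosh z = 1 + 2 * Real.sinh (z / 2) ^ 2 := by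
    have := Real.cosh_two_mul (z / 2)
    rw [Real.cosh_sq] at this
    rw [show z = 2 * (z / 2) by ring, this]
    ring_nf
  have h2 : (z / 2) ^ 2 ≤ Real.sinh (z / 2) ^ 2 := by
    rcases le_total 0 (z / 2) with h | h
    · have := Real.self_le_sinh_iff.2 h
      gcongr
    · have := Real.sinh_le_self_iff.2 h
      nlinarith
  rw [h1]; nlinarith

/-- The even positive solitary wave with maximum `U` at the origin, described by its
first integral and its equation in divergence form. -/
structure IsSoliton (k c q U : ℝ) (u u' : ℝ → ℝ) : Prop where
  hasDerivAt : ∀ x, HasDerivAt u (u' x) x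
  continuous_deriv : Continuous u'
  pos : ∀ x, 0 < u x
  le_max : ∀ x, u x ≤ U
  apply_zero : u 0 = U
  first_integral : ∀ x, (1 + 2 * k * u x ^ 2) * u' x ^ 2
    = c * U ^ q * u x ^ 2 - c * (u x ^ 2 * (u x ^ 2) ^ (q / 2))
  deriv_nonneg : ∀ x ≤ 0, 0 ≤ u' x
  deriv_nonpos : ∀ x, 0 ≤ x → u' x ≤ 0
  equation : ∀ x, HasDerivAt (fun x => (1 + 2 * k * u x ^ 2) * u' x)
    (2 * k * u x * u' x ^ 2 + c * U ^ q * u x - (q + 2) / 2 * c * (u x * u x ^ q)) x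
  memLp : MemLp u 2
  memLp_deriv : MemLp u' 2

/-- For k = 0 the soliton is U cosh(ax)^(-2/q). For general k the same profile is kept and x is
reparametrized by z' = a/√(1 + 2ky²), so that the new factor in the first integral is absorbed by
the change of variable. -/
theorem exists_isSoliton {k c q U : ℝ} (hk : 0 ≤ k) (hc : 0 < c) (hq : 0 < q) (hq4 : q < 4)
    (hU : 0 < U) : ∃ u u' : ℝ → ℝ, IsSoliton k c q U u u' := by
  set μ := c * U ^ q with hμ
  have hμ0 : 0 < μ := by positivity
  have hs0 : 0 < √μ := Real.sqrt_pos.2 hμ0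
  have hs2 : √μ * √μ = μ := Real.mul_self_sqrt hμ0.le
  set y : ℝ → ℝ := fun z => U * Real.cosh z ^ (-(2 / q)) with hy
  have hch : ∀ z, 0 < Real.cosh z := Real.cosh_pos
  have hypos : ∀ z, 0 < y z := fun z => by have := hch z; simp only [hy]; positivity
  have hyle : ∀ z, y z ≤ U := fun z => by
    have : Real.cosh z ^ (-(2 / q)) ≤ 1 :=
      Real.rpow_le_one_of_one_le_of_nonpos (Real.one_le_cosh z) (by
        have : 0 < 2 / q := by positivity
        linarith)
    simp only [hy]; nlinarith
  have hyd : ∀ z, HasDerivAt y (-(2 / q) * y z * (Real.sinh z / Real.cosh z)) z := by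
    intro z
    have := ((Real.hasDerivAt_cosh z).rpow_const (p := -(2 / q)) (Or.inl (hch z).ne')).const_mul U
    refine this.congr_deriv ?_
    rw [Real.rpow_sub_one (hch z).ne']
    simp only [hy]
    field_simp
  have hycont : Continuous y := continuous_iff_continuousAt.2 fun z => (hyd z).continuousAt
  have hyq : ∀ z, y z ^ q = U ^ q * (1 / Real.cosh z ^ 2) := by
    intro z
    simp only [hy]
    rw [Real.mul_rpow hU.le (Real.rpow_nonneg (hch z).le _), ← Real.rpow_mul (hch z).le]
    congr 1
    rw [show -(2 / q) * q = -(2 : ℝ) by field_simp, Real.rpow_neg (hch z).le]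
    norm_num
  set D : ℝ → ℝ := fun z => √(1 + 2 * k * y z ^ 2) with hD
  have hD2 : ∀ z, D z ^ 2 = 1 + 2 * k * y z ^ 2 := fun z => Real.sq_sqrt (by positivity)
  have hDpos : ∀ z, 0 < D z := fun z => Real.sqrt_pos.2 (by positivity)
  have hDcont : Continuous D := by simp only [hD]; fun_prop
  -- This speed cancels the factor 2/q in y' and leaves √(1 + 2ku²) u' = -√μ u tanh z.
  set a := q / 2 * √μ with ha
  have ha0 : 0 < a := by positivity
  obtain ⟨z, hzd, hz0, hzm, hzb⟩ := exists_hasDerivAt_inv (D := fun z => D z / a)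
    (m := 1 / a) (b := √(1 + 2 * k * U ^ 2) / a) (hDcont.div_const a) (by positivity)
    (fun z => by
      gcongr
      exact Real.one_le_sqrt.2 (by have := mul_nonneg hk (sq_nonneg (y z)); linarith))
    (fun z => by
      have := hyle z
      have := (hypos z).le
      simp only [hD]
      gcongr)
  have hzcont : Continuous z := continuous_iff_continuousAt.2 fun x => (hzd x).continuousAt
  set u : ℝ → ℝ := fun x => y (z x) with hu
  set T : ℝ → ℝ := fun x => Real.sinh (z x) / Real.cosh (z x) with hT
  set u' : ℝ → ℝ := fun x => -√μ * u x * T x / D (z x) with hu'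
  have hud : ∀ x, HasDerivAt u (u' x) x := by
    intro x
    refine ((hyd (z x)).comp x (hzd x)).congr_deriv ?_
    have := (hDpos (z x)).ne'
    simp only [hu', hu, hT, ha]
    field_simp
  have hucont : Continuous u := hycont.comp hzcont
  have hTcont : Continuous T :=
    (Real.continuous_sinh.comp hzcont).div (Real.continuous_cosh.comp hzcont) fun x => (hch _).ne'
  have hDzcont : Continuous fun x => D (z x) := hDcont.comp hzcont
  have hu'cont : Continuous u' :=
    ((continuous_const.mul hucont).mul hTcont).div hDzcont fun x => (hDpos _).ne'
  have hT2 : ∀ x, T x ^ 2 = 1 - 1 / Real.cosh (z x) ^ 2 := by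
    intro x
    have := (hch (z x)).ne'
    simp only [hT]
    rw [div_pow, Real.sinh_sq]
    field_simp
  have hTd : ∀ x, HasDerivAt T (1 / Real.cosh (z x) ^ 2 * (D (z x) / a)⁻¹) x := by
    intro x
    have h := ((Real.hasDerivAt_sinh (z x)).div (Real.hasDerivAt_cosh (z x)) (hch _).ne').comp x
      (hzd x)
    refine h.congr_deriv ?_
    congr 2
    have := Real.cosh_sq (z x)
    nlinarith
  have hDd : ∀ x, HasDerivAt (fun x => D (z x)) (2 * k * u x * u' x / D (z x)) x := by
    intro x
    have h1 : HasDerivAt (fun x => 1 + 2 * k * u x ^ 2) (4 * k * u x * u' x) x := by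
      have := (((hud x).pow 2).const_mul (2 * k)).const_add 1
      refine this.congr_deriv ?_
      push_cast; ring
    have h2 := h1.sqrt (by have := hypos (z x); positivity)
    refine h2.congr_deriv ?_
    simp only [hD, hu]
    have := (hDpos (z x)).ne'
    simp only [hD] at this
    field_simp
    ring
  have hsq : ∀ x, u x ^ 2 ≤ U ^ 2 * (1 + z x ^ 2 / 2)⁻¹ := by
    intro x
    simp only [hu, hy]
    rw [mul_pow, ← Real.rpow_natCast (_ ^ _), ← Real.rpow_mul (hch _).le]
    -- Here q < 4 gives 4/q ≥ 1, so u² decays at least like 1/cosh z; the crude quadratic bound on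
    -- cosh then suffices for integrability.
    have h1 : Real.cosh (z x) ^ (-(2 / q) * ((2 : ℕ) : ℝ)) ≤ Real.cosh (z x) ^ (-1 : ℝ) := by
      refine Real.rpow_le_rpow_of_exponent_le (Real.one_le_cosh _) ?_
      have : 1 ≤ 4 / q := by rw [le_div_iff₀ hq]; linarith
      push_cast
      have : -(2 / q) * 2 = -(4 / q) := by ring
      linarith
    rw [Real.rpow_neg_one] at h1
    have h2 : (Real.cosh (z x))⁻¹ ≤ (1 + z x ^ 2 / 2)⁻¹ :=
      inv_anti₀ (by positivity) (one_add_sq_div_two_le_cosh _)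
    have := h1.trans h2
    gcongr
  set b := √(1 + 2 * k * U ^ 2) / a with hb
  have hbpos : 0 < b := div_pos (Real.sqrt_pos.2 (by positivity)) ha0
  set β := 1 / (2 * b) with hβ
  have hsq2 : ∀ x, u x ^ 2 ≤ U ^ 2 * (1 + (β * x) ^ 2)⁻¹ := by
    intro x
    refine (hsq x).trans ?_
    have h1 : x ^ 2 ≤ b ^ 2 * z x ^ 2 := by
      rw [← mul_pow, ← sq_abs x, ← sq_abs (b * z x), abs_mul, abs_of_pos hbpos]
      have := hzb x
      gcongr
    have h2 : (β * x) ^ 2 ≤ z x ^ 2 / 2 := by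
      rw [hβ, div_mul_eq_mul_div, one_mul, div_pow, div_le_iff₀ (by positivity)]
      nlinarith [sq_nonneg (z x), sq_nonneg b]
    gcongr
  have hβ0 : β ≠ 0 := by positivity
  have iu : Integrable fun x => u x ^ 2 := by
    refine ((integrable_inv_one_add_sq.comp_mul_left' hβ0).const_mul (U ^ 2)).mono'
      (Continuous.aestronglyMeasurable (by fun_prop)) (ae_of_all _ fun x => ?_)
    rw [Real.norm_of_nonneg (sq_nonneg _)]
    exact hsq2 x
  have mu : MemLp u 2 := (memLp_two_iff_integrable_sq hucont.aestronglyMeasurable).2 iu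
  have hT1 : ∀ x, T x ^ 2 ≤ 1 := fun x => by
    rw [hT2]; have : 0 ≤ 1 / Real.cosh (z x) ^ 2 := by positivity
    linarith
  have hD1 : ∀ x, 1 ≤ D (z x) ^ 2 := fun x => by
    rw [hD2]; have := mul_nonneg hk (sq_nonneg (y (z x))); linarith
  have hDu' : ∀ x, D (z x) * u' x = -√μ * u x * T x := fun x => by
    have := (hDpos (z x)).ne'
    simp only [hu']; field_simp
  -- This becomes the first integral because tanh² z = 1 - 1/cosh² z = 1 - (u/U)^q.
  have hfi : ∀ x, D (z x) ^ 2 * u' x ^ 2 = μ * u x ^ 2 * T x ^ 2 := fun x => by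
    rw [← mul_pow, hDu']
    linear_combination (u x ^ 2 * T x ^ 2) * hs2
  have mu' : MemLp u' 2 := by
    refine (memLp_two_iff_integrable_sq hu'cont.aestronglyMeasurable).2 ?_
    refine (iu.const_mul μ).mono' (Continuous.aestronglyMeasurable (by fun_prop))
      (ae_of_all _ fun x => ?_)
    rw [Real.norm_of_nonneg (sq_nonneg _)]
    calc u' x ^ 2 ≤ D (z x) ^ 2 * u' x ^ 2 := le_mul_of_one_le_left (sq_nonneg _) (hD1 x)
      _ = μ * u x ^ 2 * T x ^ 2 := hfi x
      _ ≤ μ * u x ^ 2 := mul_le_of_le_one_right (by positivity) (hT1 x)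
  refine ⟨u, u', hud, hu'cont, fun x => hypos _, fun x => hyle _, ?_, fun x => ?_, fun x hx => ?_,
    fun x hx => ?_, fun x => ?_, mu, mu'⟩
  · simp [hu, hy, hz0]
  · have h1 := hfi x
    rw [hD2] at h1
    have h2 : (u x ^ 2) ^ (q / 2) = u x ^ q := by
      rw [← Real.rpow_natCast, ← Real.rpow_mul (hypos _).le]; congr 1; push_cast; ring
    rw [h2, h1, hT2]
    simp only [hu, hyq]
    rw [hμ]; ring
  · have hz : z x ≤ 0 := hz0 ▸ hzm hx
    have hTx : T x ≤ 0 := div_nonpos_of_nonpos_of_nonneg (Real.sinh_nonpos_iff.2 hz) (hch _).le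
    refine div_nonneg ?_ (hDpos _).le
    have := mul_pos hs0 (hypos (z x))
    simp only [hu]
    nlinarith
  · have hz : 0 ≤ z x := hz0 ▸ hzm hx
    have hTx : 0 ≤ T x := div_nonneg (Real.sinh_nonneg_iff.2 hz) (hch _).le
    refine div_nonpos_of_nonpos_of_nonneg ?_ (hDpos _).le
    have := mul_pos hs0 (hypos (z x))
    simp only [hu]
    nlinarith
  -- Writing the flux as D · (-√μ u T) allows it to be differentiated without a second derivative of
  -- u.
  · have hP : (fun x => (1 + 2 * k * u x ^ 2) * u' x)
        = fun x => D (z x) * (-√μ * (u x * T x)) := by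
      funext x
      rw [← mul_assoc (-√μ), ← hDu', ← mul_assoc, ← sq, hD2]
    rw [hP]
    have hW := ((hud x).mul (hTd x)).const_mul (-√μ)
    refine ((hDd x).mul hW).congr_deriv ?_
    have hne := (hDpos (z x)).ne'
    have e1 : 2 * k * u x * u' x / D (z x) * (-√μ * (u x * T x)) = 2 * k * u x * u' x ^ 2 := by
      rw [← mul_assoc (-√μ), ← hDu']; field_simp
    have e2 : D (z x) * (-√μ * (u' x * T x
        + u x * (1 / Real.cosh (z x) ^ 2 * (D (z x) / a)⁻¹)))
        = √μ * √μ * u x * T x ^ 2 - √μ * a * u x * (1 / Real.cosh (z x) ^ 2) := by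
      have : D (z x) * (-√μ * (u' x * T x
        + u x * (1 / Real.cosh (z x) ^ 2 * (D (z x) / a)⁻¹)))
        = -√μ * (D (z x) * u' x) * T x
          - √μ * u x * (1 / Real.cosh (z x) ^ 2) * (D (z x) * (D (z x) / a)⁻¹) := by ring
      rw [this, hDu', inv_div, mul_div_cancel₀ _ hne]
      ring
    rw [Pi.mul_apply, e1, e2, hT2, ha]
    rw [show √μ * (q / 2 * √μ) = q / 2 * (√μ * √μ) by ring, hs2]
    have e3 : u x ^ q = U ^ q * (1 / Real.cosh (z x) ^ 2) := hyq _
    rw [e3, hμ]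
    ring

/-! ### Energy, weak equation, action and mass of the soliton. -/

theorem LocAC.memH1_ofReal {u u' : ℝ → ℝ} (h : LocAC u u') (m : MemLp u 2) (m' : MemLp u' 2) :
    MemH1 fun x => (u x : ℂ) :=
  ⟨m.ofReal, _, h.hasWeakDeriv.clm_comp Complex.ofRealCLM, m'.ofReal⟩

/-- The energy of a real-valued function. -/
theorem LocAC.energy_ofReal {k θ p : ℝ} (hp : 0 < p) {u u' : ℝ → ℝ} (h : LocAC u u') :
    energy k θ p (fun x => (u x : ℂ)) = ∫ x, (1 / 2 * u' x ^ 2 + k / 4 * (2 * u x * u' x) ^ 2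
      - (2 * θ / p) / 2 * (u x ^ 2 * (u x ^ 2) ^ ((p - 2) / 2))) := by
  have h0 : LocAC (fun _ => (0 : ℝ)) (fun _ => 0) :=
    LocAC.of_hasDerivAt (fun x => hasDerivAt_const x 0) continuous_const
  have := energy_eq_integral (k := k) (θ := θ) hp (w := fun x => (u x : ℂ))
    (g := fun x => (u' x : ℂ)) (A := u) (B := fun _ => 0) h h0
    (ae_of_all _ fun x => ⟨rfl, rfl⟩)
    (h.hasWeakDeriv.clm_comp Complex.ofRealCLM).weakDeriv_ae_eq
  rw [this]
  simp

theorem integral_add_sub_const_mul {f g h : ℝ → ℝ} (hf : Integrable f) (hg : Integrable g)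
    (hh : Integrable h) (a b c : ℝ) :
    ∫ x, (a * f x + b * g x - c * h x) = a * (∫ x, f x) + b * (∫ x, g x) - c * (∫ x, h x) := by
  have i : Integrable fun x => a * f x + b * g x := (hf.const_mul a).add (hg.const_mul b)
  rw [integral_sub i (hh.const_mul c), integral_add (hf.const_mul a) (hg.const_mul b),
    integral_const_mul, integral_const_mul, integral_const_mul]

namespace IsSoliton

variable {k c q U : ℝ} {u u' : ℝ → ℝ}

theorem locAC (h : IsSoliton k c q U u u') : LocAC u u' :=
  LocAC.of_hasDerivAt h.hasDerivAt h.continuous_deriv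

theorem continuous (h : IsSoliton k c q U u u') : Continuous u := h.locAC.continuous

theorem sq_le (h : IsSoliton k c q U u u') (x : ℝ) : u x ^ 2 ≤ U ^ 2 :=
  pow_le_pow_left₀ (h.pos x).le (h.le_max x) 2

theorem sq_deriv_le (h : IsSoliton k c q U u u') (hk : 0 ≤ k) (hc : 0 < c) (x : ℝ) :
    u' x ^ 2 ≤ c * U ^ q * u x ^ 2 := by
  have h1 := h.first_integral x
  have h2 : 0 ≤ c * (u x ^ 2 * (u x ^ 2) ^ (q / 2)) := by positivity
  nlinarith [mul_nonneg (mul_nonneg hk (sq_nonneg (u x))) (sq_nonneg (u' x))]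

theorem memLp_mul_sq_deriv (h : IsSoliton k c q U u u') (hk : 0 ≤ k) (hc : 0 < c) (hU : 0 < U) :
    MemLp (fun x => u x * u' x ^ 2) 2 := by
  have := h.continuous
  have := h.continuous_deriv
  refine (h.memLp.const_mul (c * U ^ q * U ^ 2)).mono'
    (Continuous.aestronglyMeasurable (by fun_prop)) (ae_of_all _ fun x => ?_)
  have hp := h.pos x
  rw [Real.norm_of_nonneg (by positivity), mul_comm]
  gcongr
  exact (h.sq_deriv_le hk hc x).trans (mul_le_mul_of_nonneg_left (h.sq_le x) (by positivity))

theorem memLp_mul_rpow (h : IsSoliton k c q U u u') (hq : 0 < q) :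
    MemLp (fun x => u x * u x ^ q) 2 := by
  have := h.continuous
  have : Continuous fun x => u x ^ q := h.continuous.rpow_const fun x => Or.inr hq.le
  refine (h.memLp.const_mul (U ^ q)).mono'
    (Continuous.aestronglyMeasurable (by fun_prop)) (ae_of_all _ fun x => ?_)
  have hp := h.pos x
  rw [Real.norm_of_nonneg (by positivity), mul_comm]
  gcongr
  exact h.le_max x

theorem memLp_sq_mul_deriv (h : IsSoliton k c q U u u') :
    MemLp (fun x => u x ^ 2 * u' x) 2 := by
  have := h.continuous
  have := h.continuous_deriv
  refine (h.memLp_deriv.norm.const_mul (U ^ 2)).mono'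
    (Continuous.aestronglyMeasurable (by fun_prop)) (ae_of_all _ fun x => ?_)
  rw [norm_mul, Real.norm_of_nonneg (sq_nonneg _)]
  exact mul_le_mul_of_nonneg_right (h.sq_le x) (norm_nonneg _)

/-- The weak form of the soliton equation. -/
theorem integral_equation (h : IsSoliton k c q U u u') (hk : 0 ≤ k) (hc : 0 < c) (hq : 0 < q)
    (hU : 0 < U) {V V' : ℝ → ℝ} (hV : LocAC V V') (mV : MemLp V 2) (mV' : MemLp V' 2) :
    (∫ x, u' x * V' x) + c * U ^ q * (∫ x, u x * V x)
      + k * (∫ x, 2 * u x * u' x * (u' x * V x + u x * V' x))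
      - (q + 2) / 2 * c * (∫ x, u x ^ q * u x * V x) = 0 := by
  have m1 := h.memLp_mul_sq_deriv hk hc hU
  have m2 := h.memLp_mul_rpow hq
  have m3 := h.memLp_sq_mul_deriv
  have hcu := h.continuous
  have hcu' := h.continuous_deriv
  have hcq : Continuous fun x => u x ^ q := h.continuous.rpow_const fun x => Or.inr hq.le
  have hP := LocAC.of_hasDerivAt h.equation (by fun_prop)
  have mP : MemLp (fun x => (1 + 2 * k * u x ^ 2) * u' x) 2 := by
    refine (h.memLp_deriv.add (m3.const_mul (2 * k))).ae_eq (ae_of_all _ fun x => ?_)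
    simp only [Pi.add_apply]; ring
  have mP' : MemLp (fun x => 2 * k * u x * u' x ^ 2 + c * U ^ q * u x
      - (q + 2) / 2 * c * (u x * u x ^ q)) 2 := by
    refine (((m1.const_mul (2 * k)).add (h.memLp.const_mul (c * U ^ q))).sub
      (m2.const_mul ((q + 2) / 2 * c))).ae_eq (ae_of_all _ fun x => ?_)
    simp only [Pi.add_apply, Pi.sub_apply]; ring
  -- Integration by parts of the flux (1 + 2ku²)u' against `V`. Since (u²)'(uV)' = 2uu'(u'V + uV'),
  -- the integrand regroups into the weak form.
  have key := hP.integral_mul_add_mul_eq_zero hV mP mP' mV mV'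
  have i1 : Integrable fun x => u' x * V' x := h.memLp_deriv.integrable_mul mV'
  have i2 : Integrable fun x => u x * V x := h.memLp.integrable_mul mV
  have i3 : Integrable fun x => 2 * u x * u' x * (u' x * V x + u x * V' x) := by
    refine (((m1.integrable_mul mV).const_mul 2).add
      ((m3.integrable_mul mV').const_mul 2)).congr (ae_of_all _ fun x => ?_)
    simp only [Pi.add_apply, Pi.mul_apply]; ring
  have i4 : Integrable fun x => u x ^ q * u x * V x := by
    refine (m2.integrable_mul mV).congr (ae_of_all _ fun x => ?_)
    simp only [Pi.mul_apply]; ring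
  have i5 : Integrable fun x => u' x * V' x + c * U ^ q * (u x * V x) := i1.add (i2.const_mul _)
  have e5 : (∫ x, u' x * V' x) + c * U ^ q * (∫ x, u x * V x)
      = ∫ x, (u' x * V' x + c * U ^ q * (u x * V x)) := by
    rw [integral_add i1 (i2.const_mul _), integral_const_mul]
  have e6 := integral_add_sub_const_mul i5 i3 i4 1 k ((q + 2) / 2 * c)
  rw [one_mul] at e6
  rw [e5, ← e6, ← key]
  refine integral_congr_ae (ae_of_all _ fun x => ?_)
  ring

theorem integrable_sq_mul_rpow (h : IsSoliton k c q U u u') (hq : 0 < q) :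
    Integrable fun x => u x ^ 2 * (u x ^ 2) ^ (q / 2) := by
  refine ((h.memLp_mul_rpow hq).integrable_mul h.memLp).congr (ae_of_all _ fun x => ?_)
  have h2 : (u x ^ 2) ^ (q / 2) = u x ^ q := by
    rw [← Real.rpow_natCast, ← Real.rpow_mul (h.pos x).le]; congr 1; push_cast; ring
  simp only [Pi.mul_apply]
  rw [h2]; ring

theorem integrable_mul_deriv_sq (h : IsSoliton k c q U u u') (hk : 0 ≤ k) (hc : 0 < c)
    (hU : 0 < U) : Integrable fun x => (2 * u x * u' x) ^ 2 := by
  refine (((h.memLp_mul_sq_deriv hk hc hU).integrable_mul h.memLp).const_mul 4).congr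
    (ae_of_all _ fun x => ?_)
  simp only [Pi.mul_apply]; ring

/-- The soliton equation tested against the soliton itself. -/
theorem nehari (h : IsSoliton k c q U u u') (hk : 0 ≤ k) (hc : 0 < c) (hq : 0 < q) (hU : 0 < U) :
    (∫ x, u' x ^ 2) + c * U ^ q * (∫ x, u x ^ 2) + k * (∫ x, (2 * u x * u' x) ^ 2)
      - (q + 2) / 2 * c * (∫ x, u x ^ 2 * (u x ^ 2) ^ (q / 2)) = 0 := by
  have key := h.integral_equation hk hc hq hU h.locAC h.memLp h.memLp_deriv
  have h2 : ∀ x, (u x ^ 2) ^ (q / 2) = u x ^ q := fun x => by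
    rw [← Real.rpow_natCast, ← Real.rpow_mul (h.pos x).le]; congr 1; push_cast; ring
  rw [← key]
  simp_rw [h2]
  congr 1
  · congr 1
    · congr 1
      · congr 1; funext x; ring
      · congr 2; funext x; ring
    · congr 2; funext x; ring
  · congr 2; funext x; ring

/-- The action of the soliton. -/
theorem action_eq (h : IsSoliton k c q U u u') (hk : 0 ≤ k) (hc : 0 < c) (hq : 0 < q)
    (hU : 0 < U) :
    action k c q U = 1 / 2 * (∫ x, u' x ^ 2) + k / 4 * (∫ x, (2 * u x * u' x) ^ 2)
      - c / 2 * (∫ x, u x ^ 2 * (u x ^ 2) ^ (q / 2)) + c * U ^ q * (1 / 2 * ∫ x, u x ^ 2) := by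
  have i1 := h.memLp_deriv.integrable_sq
  have i2 := h.integrable_mul_deriv_sq hk hc hU
  have i3 := h.integrable_sq_mul_rpow hq
  have i4 := h.memLp.integrable_sq
  have hρ := h.locAC.sq
  have hQ := continuous_actionDensity (k := k) (c := c) (M := U) hq
  have hG := hρ.comp (hasDerivAt_integral_actionDensity (k := k) (c := c) (M := U) hq) hQ
  have iρ' : Integrable (fun x => 2 * u x * u' x) := by
    refine ((h.memLp.integrable_mul h.memLp_deriv).const_mul 2).congr (ae_of_all _ fun x => ?_)
    simp only [Pi.mul_apply]; ring
  -- The first integral, solved for the square root: this is equality in the AM-GM bound.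
  have hdens : ∀ x, actionDensity k c q U (u x ^ 2) * u x = (1 + 2 * k * u x ^ 2) * |u' x| := by
    intro x
    have hp := h.pos x
    have hsq : (1 + 2 * k * u x ^ 2) * (c * U ^ q - c * (u x ^ 2) ^ (q / 2))
        = ((1 + 2 * k * u x ^ 2) * |u' x| / u x) ^ 2 := by
      rw [div_pow, mul_pow, sq_abs, sq (1 + _), mul_assoc (1 + _), h.first_integral x]
      field_simp
    rw [actionDensity, hsq, Real.sqrt_sq (by positivity)]
    field_simp
  set e : ℝ → ℝ := fun x => (1 + 2 * k * u x ^ 2) * u' x ^ 2 with he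
  have hleft : ∀ x ∈ Iic (0 : ℝ), e x
      = 1 / 2 * (actionDensity k c q U (u x ^ 2) * (2 * u x * u' x)) := by
    intro x hx
    have := hdens x
    rw [abs_of_nonneg (h.deriv_nonneg x hx)] at this
    simp only [he]
    linear_combination (-u' x) * this
  have hright : ∀ x ∈ Ioi (0 : ℝ), e x
      = -(1 / 2) * (actionDensity k c q U (u x ^ 2) * (2 * u x * u' x)) := by
    intro x hx
    have := hdens x
    rw [abs_of_nonpos (h.deriv_nonpos x (le_of_lt hx))] at this
    simp only [he]
    linear_combination (u' x) * this
  obtain ⟨b, hb⟩ := isCompact_Icc.exists_bound_of_continuousOn (s := Icc 0 (U ^ 2))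
    hQ.continuousOn
  have iG : Integrable (fun x => actionDensity k c q U (u x ^ 2) * (2 * u x * u' x)) :=
    iρ'.bdd_mul (c := b) (hQ.comp hρ.continuous).aestronglyMeasurable
      (ae_of_all _ fun x => hb _ ⟨by positivity, h.sq_le x⟩)
  have cG : Continuous (fun s => ∫ σ in (0 : ℝ)..s, actionDensity k c q U σ) :=
    continuous_iff_continuousAt.2 fun s =>
      (hasDerivAt_integral_actionDensity (k := k) (c := c) (M := U) hq s).continuousAt
  have e1 := hG.integral_Iic_of_tendsto iG
    ((cG.tendsto 0).comp (hρ.tendsto_atBot_zero i4 iρ')) 0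
  have e2 := hG.integral_Ioi_of_tendsto iG
    ((cG.tendsto 0).comp (hρ.tendsto_atTop_zero i4 iρ')) 0
  simp only [h.apply_zero, intervalIntegral.integral_same] at e1 e2
  have hpt : ∀ x, 1 / 2 * u' x ^ 2 + k / 4 * (2 * u x * u' x) ^ 2
      - c / 2 * (u x ^ 2 * (u x ^ 2) ^ (q / 2)) + c * U ^ q * (1 / 2 * u x ^ 2) = e x := by
    intro x
    have := h.first_integral x
    simp only [he]
    linear_combination (-1 / 2) * this
  have iE := ((i1.const_mul (1 / 2)).add (i2.const_mul (k / 4))).sub (i3.const_mul (c / 2))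
  have iM := (i4.const_mul (1 / 2)).const_mul (c * U ^ q)
  have ie : Integrable e := (iE.add iM).congr (ae_of_all _ hpt)
  have l3 := intervalIntegral.integral_Iic_add_Ioi (b := 0) ie.integrableOn ie.integrableOn
  rw [setIntegral_congr_fun measurableSet_Iic hleft, setIntegral_congr_fun measurableSet_Ioi hright,
    integral_const_mul, integral_const_mul, e1, e2] at l3
  have tot : ∫ x, e x = 1 / 2 * (∫ x, u' x ^ 2) + k / 4 * (∫ x, (2 * u x * u' x) ^ 2)
      - c / 2 * (∫ x, u x ^ 2 * (u x ^ 2) ^ (q / 2)) + c * U ^ q * (1 / 2 * ∫ x, u x ^ 2) := by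
    rw [← integral_add_sub_const_mul i1 i2 i3, ← integral_const_mul (1 / 2) (fun x => u x ^ 2),
      ← integral_const_mul (c * U ^ q), ← integral_add (by exact iE) iM]
    exact integral_congr_ae (ae_of_all _ fun x => (hpt x).symm)
  rw [← tot, ← l3, action]
  ring

/-- Lower bound for the energy of multiples of the soliton. -/
theorem action_mul_le (h : IsSoliton k c q U u u') (hk : 0 ≤ k) (hc : 0 < c) (hq : 0 < q)
    (hU : 0 < U) {t : ℝ} (ht : 0 < t) :
    action k c q (t * U) ≤ t ^ 2 / 2 * (∫ x, u' x ^ 2)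
      + k / 4 * t ^ 4 * (∫ x, (2 * u x * u' x) ^ 2)
      - c / 2 * t ^ (q + 2) * (∫ x, u x ^ 2 * (u x ^ 2) ^ (q / 2))
      + c * (t * U) ^ q * (t ^ 2 / 2 * ∫ x, u x ^ 2) := by
  have i1 := h.memLp_deriv.integrable_sq
  have i2 := h.integrable_mul_deriv_sq hk hc hU
  have i3 := h.integrable_sq_mul_rpow hq
  have h0 : LocAC (fun _ => (0 : ℝ)) (fun _ => 0) :=
    LocAC.of_hasDerivAt (fun x => hasDerivAt_const x 0) continuous_const
  have ht' : LocAC (fun x => t * u x) (fun x => t * u' x) :=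
    LocAC.of_hasDerivAt (fun x => (h.hasDerivAt x).const_mul t)
      (continuous_const.mul h.continuous_deriv)
  -- The multiple tu has maximum tU, attained at the origin, and zero imaginary part.
  have key := action_le (M := t * U) ht' h0 (h.memLp.const_mul t) MemLp.zero'
    (h.memLp_deriv.const_mul t) MemLp.zero' hk hc hq (by positivity) (fun x => by
      have := h.sq_le x
      simp only [mul_pow]
      nlinarith [sq_nonneg t]) (x₀ := 0) (by simp [h.apply_zero])
  have hpow : t ^ 2 * (t ^ 2) ^ (q / 2) = t ^ (q + 2) := by
    have : (t ^ 2) ^ (q / 2) = t ^ q := by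
      rw [← Real.rpow_natCast, ← Real.rpow_mul ht.le]; congr 1; push_cast; ring
    rw [this, Real.rpow_add ht]
    norm_num [mul_comm]
  refine key.trans (le_of_eq ?_)
  have e1 : ∀ x, 1 / 2 * ((t * u' x) ^ 2 + 0 ^ 2)
      + k / 4 * (2 * (t * u x) * (t * u' x) + 2 * 0 * 0) ^ 2
      - c / 2 * (((t * u x) ^ 2 + 0 ^ 2) * ((t * u x) ^ 2 + 0 ^ 2) ^ (q / 2))
      = t ^ 2 / 2 * u' x ^ 2 + k / 4 * t ^ 4 * (2 * u x * u' x) ^ 2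
        - c / 2 * t ^ (q + 2) * (u x ^ 2 * (u x ^ 2) ^ (q / 2)) := by
    intro x
    rw [show (t * u x) ^ 2 + 0 ^ 2 = t ^ 2 * u x ^ 2 by ring,
      Real.mul_rpow (by positivity) (by positivity), ← hpow]
    ring
  have e2 : ∀ x, (t * u x) ^ 2 + 0 ^ 2 = t ^ 2 * u x ^ 2 := fun x => by ring
  simp_rw [e1, e2]
  rw [integral_add_sub_const_mul i1 i2 i3, integral_const_mul]
  ring

theorem isPositiveSolution {θ p : ℝ} (h : IsSoliton k (2 * θ / p) (p - 2) U u u') (hk : 0 ≤ k)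
    (hθ : 0 < θ) (hp : 2 < p) (hU : 0 < U) :
    IsPositiveSolution k θ (2 * θ / p * U ^ (p - 2)) p u := by
  refine ⟨h.continuous, h.pos, h.locAC.memH1 h.memLp h.memLp_deriv, fun v hv => ?_⟩
  obtain ⟨V, V', hV, hvV, mV, mV'⟩ := hv.exists_locAC
  have key := h.integral_equation hk (by positivity) (by linarith) hU hV mV mV'
  have d1 := h.locAC.weakDeriv_ae_eq EventuallyEq.rfl
  have d2 := hV.weakDeriv_ae_eq hvV
  have d3 := h.locAC.sq.weakDeriv_ae_eq EventuallyEq.rfl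
  have d4 : weakDeriv (fun y => u y * v y) =ᵐ[volume] fun x => u' x * V x + u x * V' x := by
    refine (h.locAC.mul hV).weakDeriv_ae_eq ?_
    filter_upwards [hvV] with x hx
    rw [hx]
  -- With c = 2θ/p, the coefficient (q + 2)c/2 in the soliton equation is θ.
  have hcoef : (p - 2 + 2) / 2 * (2 * θ / p) = θ := by field_simp; ring
  rw [hcoef] at key
  rw [← key]
  congr 1
  · congr 1
    · congr 1
      · refine integral_congr_ae ?_
        filter_upwards [d1, d2] with x h1 h2
        rw [h1, h2]
      · congr 1
        refine integral_congr_ae ?_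
        filter_upwards [hvV] with x h1
        rw [h1]
    · congr 1
      refine integral_congr_ae ?_
      filter_upwards [d3, d4] with x h1 h2
      rw [h1, h2]
  · congr 1
    refine integral_congr_ae ?_
    filter_upwards [hvV] with x h1
    rw [h1, abs_of_pos (h.pos x)]

/-- If the maximum of the soliton minimizes the reduced energy, then the soliton has mass `lam`. -/
theorem mass_eq (h : IsSoliton k c q U u u') (hk : 0 ≤ k) (hc : 0 < c) (hq : 0 < q) (hU : 0 < U)
    {lam : ℝ} (hmin : ∀ V : ℝ, 0 < V →
      action k c q U - c * U ^ q * lam ≤ action k c q V - c * V ^ q * lam) :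
    1 / 2 * ∫ x, u x ^ 2 = lam := by
  have hN := h.nehari hk hc hq hU
  have hA := h.action_eq hk hc hq hU
  have hlow := fun t ht => h.action_mul_le hk hc hq hU (t := t) ht
  set N := ∫ x, u' x ^ 2
  set R := ∫ x, (2 * u x * u' x) ^ 2
  set S := ∫ x, u x ^ 2 * (u x ^ 2) ^ (q / 2)
  set m := ∫ x, u x ^ 2
  -- f(t) is the upper bound for `action` (tU) from `action_mul_le`, minus c (tU)^q `lam`. It
  -- dominates the reduced energy at tU and agrees with it at t = 1, so the minimality of U passes
  -- to f.
  set f : ℝ → ℝ := fun t => t ^ 2 / 2 * N + k / 4 * t ^ 4 * R - c / 2 * t ^ (q + 2) * S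
    + c * U ^ q * (t ^ q * (t ^ 2 / 2 * m - lam)) with hf
  have hf1 : f 1 = action k c q U - c * U ^ q * lam := by
    simp only [hf, Real.one_rpow]; rw [hA]; ring
  have hloc : IsLocalMin f 1 := by
    filter_upwards [eventually_gt_nhds (zero_lt_one' ℝ)] with t ht
    rw [hf1]
    refine (hmin (t * U) (by positivity)).trans ?_
    have := hlow t ht
    rw [Real.mul_rpow ht.le hU.le] at this ⊢
    simp only [hf]
    linarith
  have hd : HasDerivAt f (N + k * R - c / 2 * (q + 2) * S
      + c * U ^ q * (q * (m / 2 - lam) + m)) 1 := by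
    have p2 : HasDerivAt (fun t : ℝ => t ^ 2 / 2) 1 1 :=
      ((hasDerivAt_pow 2 (1 : ℝ)).div_const 2).congr_deriv (by norm_num)
    have p4 : HasDerivAt (fun t : ℝ => t ^ 4) 4 1 :=
      (hasDerivAt_pow 4 (1 : ℝ)).congr_deriv (by norm_num)
    have pq2 : HasDerivAt (fun t : ℝ => t ^ (q + 2)) (q + 2) 1 :=
      (Real.hasDerivAt_rpow_const (Or.inl one_ne_zero)).congr_deriv (by simp)
    have pq : HasDerivAt (fun t : ℝ => t ^ q) q 1 :=
      (Real.hasDerivAt_rpow_const (Or.inl one_ne_zero)).congr_deriv (by simp)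
    have := (((p2.mul_const N).add ((p4.const_mul (k / 4)).mul_const R)).sub
      ((pq2.const_mul (c / 2)).mul_const S)).add
      ((pq.mul ((p2.mul_const m).sub_const lam)).const_mul (c * U ^ q))
    refine this.congr_deriv ?_
    rw [Real.one_rpow]
    ring
  have hz := hloc.hasDerivAt_eq_zero hd
  -- Subtracting the Nehari identity from f'(1) = 0 leaves only the term produced by varying t^q.
  have hfin : c * U ^ q * q * (m / 2 - lam) = 0 := by linear_combination hz - hN
  have hne : c * U ^ q * q ≠ 0 := by positivity
  have := (mul_eq_zero.1 hfin).resolve_left hne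
  linarith

end IsSoliton

/-! ### The main theorem. -/

theorem theorem4p6 (p k : ℝ) (hp4 : 4 ≤ p) (hp6 : p < 6) (hk : 0 ≤ k) :
    (∀ lam : ℝ, 0 < lam → ∀ θ : ℝ, 0 < θ →
      ∃ γ : ℝ, γ < 0 ∧ ∃ u : ℝ → ℝ,
        (fun x => (u x : ℂ)) ∈ massSphere lam ∧
        IsMinOn (energy k θ p) (massSphere lam) (fun x => (u x : ℂ)) ∧
        IsPositiveSolution k θ (-γ) p u) ∧
    (∃ γ : ℝ, γ < 0 ∧ ∀ θ : ℝ, 0 < θ → ∃ u : ℝ → ℝ, IsPositiveSolution k θ (-γ) p u) := by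
  have hq : 0 < p - 2 := by linarith
  have hp : 0 < p := by linarith
  refine ⟨fun lam hlam θ hθ => ?_, -1, by norm_num, fun θ hθ => ?_⟩
  · have hc : 0 < 2 * θ / p := by positivity
    obtain ⟨U, hU, hmin⟩ := exists_isMin_action_sub hk hc hq (by linarith) hlam
    obtain ⟨u, u', h⟩ := exists_isSoliton hk hc hq (by linarith) hU
    have hmass := h.mass_eq hk hc hq hU hmin
    have i1 := h.memLp_deriv.integrable_sq
    have i2 := h.integrable_mul_deriv_sq hk hc hU
    have i3 := h.integrable_sq_mul_rpow hq
    have hen : energy k θ p (fun x => (u x : ℂ))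
        = action k (2 * θ / p) (p - 2) U - 2 * θ / p * U ^ (p - 2) * lam := by
      rw [h.locAC.energy_ofReal hp, h.action_eq hk hc hq hU, hmass,
        integral_add_sub_const_mul i1 i2 i3]
      ring
    refine ⟨-(2 * θ / p * U ^ (p - 2)), by
      have : 0 < 2 * θ / p * U ^ (p - 2) := by positivity
      linarith, u, ⟨h.locAC.memH1_ofReal h.memLp h.memLp_deriv, ?_⟩, fun w hw => ?_, ?_⟩
    · simpa using hmass
    -- A competitor with maximal modulus M has energy at least the reduced energy at M, hence at
    -- least its minimum at U, which is the energy of u.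
    · obtain ⟨hw1, hw2⟩ := hw
      obtain ⟨M, hM, hle⟩ := hw1.exists_action_le hk hθ (p := p) (by linarith)
        (by linarith)
      rw [hw2] at hle
      have := hmin M hM
      simp only [mem_ofPred_eq, hen]
      linarith
    · rw [neg_neg]
      exact h.isPositiveSolution hk hθ (by linarith) hU
  · have hc : 0 < 2 * θ / p := by positivity
    -- This maximum solves c U^q = 1, so γ = -1 serves every θ.
    have hU : 0 < (p / (2 * θ)) ^ (1 / (p - 2)) := by positivity
    obtain ⟨u, u', h⟩ := exists_isSoliton hk hc hq (by linarith) hU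
    have hμ : 2 * θ / p * ((p / (2 * θ)) ^ (1 / (p - 2))) ^ (p - 2) = - -1 := by
      rw [← Real.rpow_mul (by positivity), one_div_mul_cancel hq.ne', Real.rpow_one]
      field_simp
    refine ⟨u, ?_⟩
    rw [← hμ]
    exact h.isPositiveSolution hk hθ (by linarith) hU
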